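/- Let $X$ be a smooth irreducible proper (in particular, projective) complex algebraic variety of dimension $n$, let $L$ be a line bundle on $X$ (in particular, an ample one, so that $(X,L)$ is a polarized variety), and let $k\ge 1$ be an integer. For $j\ge 0$ and a closed point $x\in X$ let $$\mathrm{jet}^j_x\colon H^0(X,L)\to L_x/\mathfrak m_x^{j+1}L_x=H^0(X,L\otimes\mathcal O_X/\mathfrak m_x^{j+1})$$ be the $j$-jet map; $L$ is called $j$-jet spanned if $\mathrm{jet}^j_x$ is surjective for every closed point $x\in X$. Choose a basis of $H^0(X,L)\cong\mathbb C^{m+1}$, write $\mathbb P^m=\mathbb P(H^0(X,L)^\vee)$ for the space of lines in $H^0(X,L)^\vee$, and let $(\mathbb P^m)^\vee$ be the dual projective space, whose points, the hyperplanes of $\mathbb P^m$, are the nonzero global sections of $L$ up to scalars. The $j$-th osculating space $\mathrm{Osc}^j_x\subseteq\mathbb P^m$ is the linear subspace of the functionals on $H^0(X,L)$ that factor through $\mathrm{jet}^j_x$. A hyperplane $H$ is tangent to $X$ at $x$ to the order $k$ if $\mathrm{Osc}^k_x\subseteq H$, and the $k$-th order dual variety of $(X,L)$ is the Zariski closure $$X^k=\overline{\{H\in(\mathbb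 P^m)^\vee : H \text{ is tangent to } X \text{ to the order } k \text{ at some point } x\in X\}}\subseteq(\mathbb P^m)^\vee .$$ If $L$ is $(k+1)$-jet spanned, then $X^k$ has the expected dimension, that is, $$\operatorname{codim}_{(\mathbb P^m)^\vee} X^k=\binom{n+k}{k}-n$$ (with the convention $\dim\emptyset=-1$, which is needed only for $n=0$). -/

import Mathlib

open AlgebraicGeometry CategoryTheory

noncomputable section

namespace HigherDual

/-- A line bundle on a scheme: a sheaf of modules that is locally isomorphic to the structure
sheaf. -/
class IsLineBundle {X : Scheme.{0}} (L : X.Modules) : Prop where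
  exists_trivialization : ∀ x : X, ∃ U : X.Opens, x ∈ U ∧
    Nonempty (L.restrict U.ι ≅ SheafOfModules.unit U.toScheme.ringCatSheaf)

section Jets

variable {X : Scheme.{0}} (f : X ⟶ Spec (CommRingCat.of ℂ)) (L : X.Modules)

/-- The scalars `ℂ → Γ(X, 𝒪_X)` given by the structure morphism of a complex scheme. -/
def scalars : ℂ →+* Γ(X, ⊤) :=
  f.appTop.hom.comp (Scheme.ΓSpecIso (CommRingCat.of ℂ)).inv.hom

/-- The scalars `ℂ → 𝒪_{X,x}`. -/
def stalkScalars (x : X) : ℂ →+* X.presheaf.stalk x :=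
  (X.presheaf.germ ⊤ x trivial).hom.comp (scalars f)

/-- The space `H⁰(X, L)` of global sections. The structure morphism `f` is recorded
because it gives the complex vector space structure. -/
def H0 (_f : X ⟶ Spec (CommRingCat.of ℂ)) (L : X.Modules) : Type := L.presheaf.obj (.op ⊤)

instance : AddCommGroup (H0 f L) := inferInstanceAs (AddCommGroup (L.presheaf.obj (.op ⊤)))

instance : Module ℂ (H0 f L) :=
  letI : Module Γ(X, ⊤) (H0 f L) := inferInstanceAs (Module Γ(X, ⊤) (L.presheaf.obj (.op ⊤)))
  Module.compHom (H0 f L) (scalars f)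

/-- The stalk `L_x`. -/
def Stalk (x : X) : Type := L.presheaf.stalk x

instance (x : X) : AddCommGroup (Stalk L x) :=
  inferInstanceAs (AddCommGroup (L.presheaf.stalk x))

/-- The `𝒪_{X,x}`-module structure of `L_x`. -/
instance (x : X) : Module (X.presheaf.stalk x) (Stalk L x) :=
  letI M : PresheafOfModules.{0} (X.presheaf ⋙ forget₂ CommRingCat RingCat) := L.val
  inferInstanceAs (Module (X.presheaf.stalk x) ↑(TopCat.Presheaf.stalk (C := Ab) M.presheaf x))

/-- The germ map `H⁰(X, L) → L_x`. -/
def germ (x : X) : H0 f L →+ Stalk L x := (L.presheaf.germ ⊤ x trivial).hom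

lemma germ_smul (x : X) (c : ℂ) (s : H0 f L) :
    germ f L x (c • s) = stalkScalars f x c • germ f L x s :=
  letI M : PresheafOfModules.{0} (X.presheaf ⋙ forget₂ CommRingCat RingCat) := L.val
  PresheafOfModules.germ_smul M x ⊤ trivial (scalars f c) s

/-- The space of `k`-jets of `L` at `x`, that is `L_x / 𝔪_x ^ (k + 1) L_x`, as a complex
vector space. -/
def Jets (_f : X ⟶ Spec (CommRingCat.of ℂ)) (L : X.Modules) (k : ℕ) (x : X) : Type :=
  Stalk L x ⧸ (IsLocalRing.maximalIdeal (X.presheaf.stalk x) ^ (k + 1) •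
    (⊤ : Submodule (X.presheaf.stalk x) (Stalk L x)))

instance (k : ℕ) (x : X) : AddCommGroup (Jets f L k x) :=
  inferInstanceAs (AddCommGroup (Stalk L x ⧸
    (IsLocalRing.maximalIdeal (X.presheaf.stalk x) ^ (k + 1) •
      (⊤ : Submodule (X.presheaf.stalk x) (Stalk L x)))))

instance (k : ℕ) (x : X) : Module (X.presheaf.stalk x) (Jets f L k x) :=
  inferInstanceAs (Module (X.presheaf.stalk x) (Stalk L x ⧸
    (IsLocalRing.maximalIdeal (X.presheaf.stalk x) ^ (k + 1) •
      (⊤ : Submodule (X.presheaf.stalk x) (Stalk L x)))))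

instance (k : ℕ) (x : X) : Module ℂ (Jets f L k x) :=
  Module.compHom (Jets f L k x) (stalkScalars f x)

/-- The `k`-jet map `H⁰(X, L) → L_x / 𝔪_x ^ (k + 1) L_x` at the point `x`. -/
def jet (k : ℕ) (x : X) : H0 f L →ₗ[ℂ] Jets f L k x where
  toFun s := Submodule.Quotient.mk (germ f L x s)
  map_add' s t := by
    rw [map_add]
    rfl
  map_smul' c s := by
    rw [germ_smul]
    rfl

/-- `L` is `k`-jet spanned: the `k`-jet map is surjective at every (closed) point. -/
def IsJetSpanned (k : ℕ) : Prop :=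
  ∀ x : X, IsClosed ({x} : Set X) → Function.Surjective (jet f L k x)

/-- The `k`-th osculating space at `x`, as a linear subspace of `H⁰(X, L)^∨`. The projective space
in which `X` is mapped by the global sections of `L` is the space of lines in
`H⁰(X, L)^∨`, and the image of the `k`-jet map, a quotient of `H⁰(X, L)`, defines
the subspace of the functionals that factor through the `k`-jet map. -/
def osculatingSpace (k : ℕ) (x : X) : Submodule ℂ (Module.Dual ℂ (H0 f L)) :=
  LinearMap.range (jet f L k x).dualMap

/-- The hyperplane of `H⁰(X, L)^∨` defined by a (nonzero) global section. -/
def hyperplane (s : H0 f L) : Submodule ℂ (Module.Dual ℂ (H0 f L)) :=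
  LinearMap.ker (Module.Dual.eval ℂ (H0 f L) s)

/-- The hyperplanes that are tangent to `X` to the order `k` at some point, that is, those
containing the `k`-th osculating space at some closed point. The dual projective space is the
space of lines in `H⁰(X, L)`. (On a smooth variety all points are nonsingular.) -/
def tangentHyperplanes (k : ℕ) : Set (Projectivization ℂ (H0 f L)) :=
  {H | ∃ x : X, IsClosed ({x} : Set X) ∧ osculatingSpace f L k x ≤ hyperplane f L H.rep}

end Jets

section Projective

variable {V : Type*} [AddCommGroup V] [Module ℂ V] {m : ℕ} (b : Module.Basis (Fin (m + 1)) ℂ V)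

/-- The closure of a subset of `ℙ(V)` in the Zariski topology, where the coordinates of `V`
are those of the basis `b`. -/
def zariskiClosure (Z : Set (Projectivization ℂ V)) : Set (Projectivization ℂ V) :=
  {H | ∀ (p : MvPolynomial (Fin (m + 1)) ℂ) (d : ℕ), p.IsHomogeneous d →
    (∀ z ∈ Z, MvPolynomial.eval (b.repr z.rep) p = 0) → MvPolynomial.eval (b.repr H.rep) p = 0}

/-- The affine cone over a subset of `ℙ(V)`, in coordinates; the vertex always belongs to it. -/
def affineCone (Z : Set (Projectivization ℂ V)) : Set (Fin (m + 1) → ℂ) :=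
  {v | v = 0 ∨ ∃ z ∈ Z, ∃ c : ℂ, v = c • ⇑(b.repr z.rep)}

/-- The homogeneous coordinate ring of a subset of `ℙ(V)`. -/
abbrev CoordinateRing (Z : Set (Projectivization ℂ V)) : Type :=
  MvPolynomial (Fin (m + 1)) ℂ ⧸ MvPolynomial.vanishingIdeal ℂ (affineCone b Z)

/-- A Zariski closed `Z ⊆ ℙ(V) ≅ ℙ^m` has codimension `c`, that is `dim Z + c = m`. Here `dim Z + 1`
is the Krull dimension of the homogeneous coordinate ring of `Z`
(the empty set has dimension `-1`). -/
def HasCodimension (Z : Set (Projectivization ℂ V)) (c : ℕ) : Prop :=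
  ringKrullDim (CoordinateRing b Z) + (c : WithBot ℕ∞) = ((m + 1 : ℕ) : WithBot ℕ∞)

end Projective

/-- The `k`-th order dual variety `X^k`: the Zariski closure of the set of the hyperplanes that are
tangent to `X` to the order `k` at some point. -/
def dualVariety {X : Scheme.{0}} (f : X ⟶ Spec (CommRingCat.of ℂ)) (L : X.Modules) {m : ℕ}
    (b : Module.Basis (Fin (m + 1)) ℂ (H0 f L)) (k : ℕ) : Set (Projectivization ℂ (H0 f L)) :=
  zariskiClosure b (tangentHyperplanes f L k)

end HigherDual

end

/-! ### Krull dimension and transcendence degree -/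

section KrullDimension

/-! Consider the incidence variety of the pairs `(x, s)` such that the `k`-jet of `s` at `x`
vanishes. Since the `k`-jet maps are surjective, it is a vector bundle over `X` whose fibres have
codimension `(n + k).choose k` in `H⁰(X, L)`, so it is irreducible of dimension `n + (m + 1) - (n +
k).choose k`. The closure of its image in `H⁰(X, L)` is the affine cone over `X^k`, and the theorem
amounts to the generic finiteness of this projection.

In a chart `A` with coordinates `t l`, a nonzero minor of the matrix of derivatives of the basic
sections `s i` solves the jet equations by Cramer's rule. This parametrizes the bundle by a
polynomial ring over `A` containing the coefficients `c i` of a universal section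
(`universalCoeff`). In characteristic zero, generic finiteness follows if a derivation `D` of this
ring into its fraction field that kills all `c i` is zero (`isAlgebraic_of_derivation_eq_zero`).
Applying `D` to `∑ i, c i * ∂_j^k (s i) = 0` gives `∑ l, (∑ i, c i * ∂_l ∂_j^k (s i)) * D (t l) =
0`. The matrix of this system is `leadingForm`. As the jets of order `k + 1` are spanned, some
section has the `(k + 1)`-jet of `∑ l, u l ^ (k + 1)`, where `u` are the centered coordinates; there
the matrix is `(k + 1)!` times the identity. Hence `D (t l) = 0` for all `l`, and then `D` kills the
free variables too (`isAlgebraic_range_universalHom`).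

The passage from charts to `X` uses irreducibility: a polynomial that vanishes on the fibres over
any nonempty open subset lies in the ideal of every chart (`exists_local_equations`), so all charts
give the same ideal, that of the whole cone. -/

theorem ringKrullDim_eq_of_isIntegral {R S : Type*} [CommRing R] [CommRing S] [IsDomain S]
    [Algebra R S] [Algebra.IsIntegral R S] (h : Function.Injective (algebraMap R S)) :
    ringKrullDim S = ringKrullDim R := by
  apply le_antisymm
  -- Incomparability: contraction of primes along an integral extension is strictly monotone.
  · refine Order.krullDim_le_of_strictMono (PrimeSpectrum.comap (algebraMap R S)) ?_
    intro p q hpq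
    exact Ideal.IsIntegral.comap_lt_comap hpq
  -- Lying over for the smallest prime of the chain, then going up for the rest.
  · refine iSup_le fun l => ?_
    obtain ⟨Q, hQ, hl⟩ := Ideal.exists_ideal_over_prime_of_isIntegral_of_isDomain (S := S)
      l.head.asIdeal (by
        rw [(RingHom.injective_iff_ker_eq_bot _).1 h]
        exact bot_le)
    have : Q.LiesOver l.head.asIdeal := ⟨hl.symm⟩
    obtain ⟨L, hL, -⟩ := Ideal.exists_ltSeries_of_hasGoingUp (S := S) l Q
    rw [← hL]
    exact Order.LTSeries.length_le_krullDim L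

/-- The Krull dimension of a finitely generated domain over a field is its transcendence degree. -/
theorem ringKrullDim_eq_trdeg {F R : Type} [Field F] [CommRing R] [IsDomain R] [Algebra F R]
    [Algebra.FiniteType F R] : ∃ d : ℕ, ringKrullDim R = d ∧ Algebra.trdeg F R = d := by
  obtain ⟨d, g, hg, hfin⟩ := exists_integral_inj_algHom_of_fg F R
  algebraize [g.toRingHom]
  have : Algebra.IsIntegral (MvPolynomial (Fin d) F) R := ⟨hfin⟩
  have : IsScalarTower F (MvPolynomial (Fin d) F) R := .of_algebraMap_eq' g.comp_algebraMap.symm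
  refine ⟨d, ?_, ?_⟩
  · rw [ringKrullDim_eq_of_isIntegral (R := MvPolynomial (Fin d) F) hg,
      MvPolynomial.ringKrullDim_of_isNoetherianRing, ringKrullDim_eq_zero_of_field]
    simp
  · have : FaithfulSMul (MvPolynomial (Fin d) F) R :=
      (faithfulSMul_iff_algebraMap_injective _ _).2 hg
    rw [← trdeg_add_eq F (MvPolynomial (Fin d) F) (A := R),
      trdeg_eq_zero (R := MvPolynomial (Fin d) F),
      MvPolynomial.trdeg_of_isDomain]
    simp

end KrullDimension

/-! ### Derivations and algebraic extensions -/

section Derivations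

/-- The derivations of `K` over `E` are the dual of `Ω[K⁄E]`. If this dual vanishes, so does
`Ω[K⁄E]`; the extension is then formally unramified, hence separable algebraic. -/
theorem isAlgebraic_of_forall_derivation_eq_zero {E K : Type*} [Field E] [CharZero E] [Field K]
    [Algebra E K] [Algebra.EssFiniteType E K] (h : ∀ D : Derivation E K K, D = 0) :
    Algebra.IsAlgebraic E K := by
  have : Subsingleton (Ω[K⁄E]) := by
    have : Subsingleton (Module.Dual K (Ω[K⁄E])) := by
      refine ⟨fun a b => (KaehlerDifferential.linearMapEquivDerivation E K).injective ?_⟩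
      rw [h (KaehlerDifferential.linearMapEquivDerivation E K a),
        h (KaehlerDifferential.linearMapEquivDerivation E K b)]
    exact (Module.subsingleton_dual_iff K).1 this
  have : Algebra.FormallyUnramified E K := ⟨this⟩
  have := Algebra.FormallyUnramified.isSeparable E K
  infer_instance

/-- If a domain `R` of finite type over a field of characteristic zero has no nonzero derivation
into its fraction field over the subring `B`, then it is algebraic over `B`. -/
theorem isAlgebraic_of_derivation_eq_zero {F R : Type} [Field F] [CharZero F] [CommRing R]
    [IsDomain R] [Algebra F R] [Algebra.FiniteType F R] (B : Subalgebra F R)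
    (h : ∀ D : Derivation F R (FractionRing R), (∀ b ∈ B, D b = 0) → D = 0) :
    Algebra.IsAlgebraic B R := by
  let K := FractionRing R
  let E := FractionRing B
  let : Algebra E K := FractionRing.liftAlgebra B K
  have : IsScalarTower B E K := inferInstance
  let : Algebra F E := inferInstance
  have : IsScalarTower F E K := .of_algebraMap_eq fun x => by
    rw [IsScalarTower.algebraMap_apply F B K, IsScalarTower.algebraMap_apply F B E,
      ← IsScalarTower.algebraMap_apply B E K]
  -- A derivation of the fraction fields is determined by its restriction to `R`, by the quotient
  -- rule, and this restriction kills `B`.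
  have hder : ∀ D : Derivation E K K, D = 0 := by
    intro D
    have h1 : (D.restrictScalars F).compAlgebraMap R = 0 := by
      refine h _ fun b hb => ?_
      change D (algebraMap R K b) = 0
      have : algebraMap R K b = algebraMap E K (algebraMap B E ⟨b, hb⟩) := by
        rw [← IsScalarTower.algebraMap_apply B E K]
        rfl
      rw [this, D.map_algebraMap]
    have h2 (r : R) : D (algebraMap R K r) = 0 := congr($h1 r)
    ext x
    obtain ⟨a, b, hb, rfl⟩ := IsFractionRing.div_surjective (A := R) x
    have hb' : algebraMap R K b ≠ 0 := by
      simpa using nonZeroDivisors.ne_zero hb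
    have h3 := D.leibniz (algebraMap R K a / algebraMap R K b) (algebraMap R K b)
    rw [div_mul_cancel₀ _ hb', h2, h2, smul_zero, zero_add, smul_eq_mul] at h3
    simpa [hb'] using h3.symm
  have : Algebra.EssFiniteType F K :=
    have := Algebra.EssFiniteType.of_isLocalization K (nonZeroDivisors R)
    Algebra.EssFiniteType.comp F R K
  have : Algebra.EssFiniteType E K := Algebra.EssFiniteType.of_comp F E K
  have : CharZero E := charZero_of_injective_algebraMap (algebraMap F E).injective
  have halg : Algebra.IsAlgebraic E K := isAlgebraic_of_forall_derivation_eq_zero hder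
  have : Algebra.IsAlgebraic B K := IsFractionRing.comap_isAlgebraic_iff (K := E).2 halg
  exact .of_injective (IsScalarTower.toAlgHom B R K) (IsFractionRing.injective R K)

theorem trdeg_eq_of_isAlgebraic {F R : Type} [Field F] [CommRing R] [IsDomain R] [Algebra F R]
    (B : Subalgebra F R) [Algebra.IsAlgebraic B R] : Algebra.trdeg F B = Algebra.trdeg F R := by
  rw [← trdeg_add_eq F B (A := R), trdeg_eq_zero (R := B), add_zero]

end Derivations

/-! ### Local coordinates and order of vanishing -/

/-- Local coordinates on a smooth algebra: functions whose differentials are a basis of the module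
of differentials. -/
structure LocalCoordinates (F A : Type) [CommRing F] [CommRing A] [Algebra F A] (n : ℕ) where
  /-- The coordinate functions. -/
  t : Fin n → A
  /-- The basis of the module of differentials. -/
  basis : Module.Basis (Fin n) A (Ω[A⁄F])
  basis_apply (i : Fin n) : basis i = KaehlerDifferential.D F A (t i)

namespace LocalCoordinates

variable {F A : Type} [Field F] [CommRing A] [Algebra F A] {n : ℕ} (c : LocalCoordinates F A n)

/-- The partial derivatives. -/
noncomputable def d (i : Fin n) : Derivation F A A :=
  (c.basis.coord i).compDer (KaehlerDifferential.D F A)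

lemma d_t (i j : Fin n) : c.d i (c.t j) = if j = i then 1 else 0 := by
  change c.basis.coord i (KaehlerDifferential.D F A (c.t j)) = _
  rw [← c.basis_apply, c.basis.coord_apply, c.basis.repr_self, Finsupp.single_apply]

lemma derivation_apply {M : Type*} [AddCommGroup M] [Module A M] [Module F M]
    [IsScalarTower F A M] (δ : Derivation F A M) (a : A) : δ a = ∑ i, c.d i a • δ (c.t i) := by
  conv_lhs =>
    rw [← δ.liftKaehlerDifferential_comp_D, ← c.basis.sum_repr (KaehlerDifferential.D F A a)]
  rw [map_sum]
  refine Finset.sum_congr rfl fun i _ => ?_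
  rw [map_smul, c.basis_apply, δ.liftKaehlerDifferential_comp_D]
  rfl

/-- Iterated partial derivatives, the first letter of the word being applied first. -/
noncomputable def dWord : List (Fin n) → A →ₗ[F] A
  | [] => LinearMap.id
  | i :: w => dWord w ∘ₗ (c.d i).toLinearMap

@[simp] lemma dWord_nil (a : A) : c.dWord [] a = a := rfl

@[simp] lemma dWord_cons (i : Fin n) (w : List (Fin n)) (a : A) :
    c.dWord (i :: w) a = c.dWord w (c.d i a) := rfl

lemma dWord_append_singleton (w : List (Fin n)) (i : Fin n) (a : A) :
    c.dWord (w ++ [i]) a = c.d i (c.dWord w a) := by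
  induction w generalizing a with
  | nil => rfl
  | cons j w ih => exact ih _

section Point

variable (ψ : A →ₐ[F] F)

/-- The coordinates centered at a point. -/
noncomputable def u (i : Fin n) : A := c.t i - algebraMap F A (ψ (c.t i))

lemma u_mem (i : Fin n) : c.u ψ i ∈ RingHom.ker ψ := by
  simp [u, RingHom.mem_ker]

lemma d_u (i j : Fin n) : c.d i (c.u ψ j) = if j = i then 1 else 0 := by
  rw [u, map_sub, c.d_t, Derivation.map_algebraMap, sub_zero]

lemma sub_mem_ker (a : A) : a - algebraMap F A (ψ a) ∈ RingHom.ker ψ := by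
  simp [RingHom.mem_ker]

/-- The derivation `a ↦ a - a(ψ)` with values in `A / 𝔪 ^ 2`. -/
def _root_.AlgHom.kerSqDerivation : Derivation F A (A ⧸ (RingHom.ker ψ) ^ 2) :=
  Derivation.mk'
    { toFun a := Ideal.Quotient.mk _ (a - algebraMap F A (ψ a))
      map_add' a b := by
        rw [← map_add]
        congr 1
        simp only [map_add]
        ring
      map_smul' r a := by
        rw [RingHom.id_apply, Algebra.smul_def r (Ideal.Quotient.mk _ _),
          IsScalarTower.algebraMap_apply F A (A ⧸ _), Ideal.Quotient.algebraMap_eq, ← map_mul]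
        congr 1
        simp only [Algebra.smul_def, map_mul, AlgHom.commutes, Algebra.algebraMap_self,
          RingHom.id_apply]
        ring }
    fun a b => by
      simp only [LinearMap.coe_mk, AddHom.coe_mk, Algebra.smul_def a (Ideal.Quotient.mk _ _),
        Algebra.smul_def b (Ideal.Quotient.mk _ _), Ideal.Quotient.algebraMap_eq, ← map_mul,
        ← map_add]
      rw [Ideal.Quotient.eq]
      -- The defect in the Leibniz rule is `-(a - ψ a) * (b - ψ b)`, which lies in `𝔪 ^ 2`.
      have := Ideal.mul_mem_mul (sub_mem_ker ψ a) (sub_mem_ker ψ b)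
      rw [← pow_two, ← neg_mem_iff] at this
      convert this using 1
      simp only [map_mul]
      ring

/-- This is the chain rule `derivation_apply` for the derivation `a ↦ a - ψ a` with values in `A / 𝔪
^ 2`. -/
lemma taylor_one {f : A} (hf : f ∈ RingHom.ker ψ) :
    f - ∑ i, c.d i f * c.u ψ i ∈ (RingHom.ker ψ) ^ 2 := by
  have h := c.derivation_apply ψ.kerSqDerivation f
  have h2 (a : A) : ψ.kerSqDerivation a = Ideal.Quotient.mk _ (a - algebraMap F A (ψ a)) := rfl
  simp only [h2, RingHom.mem_ker.1 hf, map_zero, sub_zero] at h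
  rw [← Ideal.Quotient.eq, h, map_sum]
  refine Finset.sum_congr rfl fun i _ => ?_
  rw [map_mul]
  rfl

/-- Euler's identity. -/
lemma euler {k : ℕ} {f : A} (hf : f ∈ (RingHom.ker ψ) ^ k) :
    (k : A) * f - ∑ i, c.d i f * c.u ψ i ∈ (RingHom.ker ψ) ^ (k + 1) := by
  induction k generalizing f with
  | zero =>
    rw [zero_add, pow_one, Nat.cast_zero, zero_mul, zero_sub, neg_mem_iff]
    exact Ideal.sum_mem _ fun i _ => Ideal.mul_mem_left _ _ (c.u_mem ψ i)
  | succ k ih =>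
    rw [pow_succ] at hf
    induction hf using Submodule.mul_induction_on' with
    | mem_mul_mem a ha b hb =>
      have h1 := Ideal.mul_mem_mul ha (c.taylor_one ψ hb)
      have h2 := Ideal.mul_mem_mul (ih ha) hb
      rw [← pow_add] at h1
      rw [← pow_succ] at h2
      convert Ideal.add_mem _ h1 h2 using 1
      have (i : Fin n) : c.d i (a * b) * c.u ψ i =
          a * (c.d i b * c.u ψ i) + b * (c.d i a * c.u ψ i) := by
        rw [Derivation.leibniz]
        simp only [smul_eq_mul]
        ring
      simp only [this, Finset.sum_add_distrib, ← Finset.mul_sum]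
      push_cast
      ring
    | add a _ b _ ha hb =>
      convert Ideal.add_mem _ ha hb using 1
      simp only [map_add, add_mul, Finset.sum_add_distrib]
      ring

lemma d_mem_pow {k : ℕ} {f : A} (hf : f ∈ (RingHom.ker ψ) ^ (k + 1)) (i : Fin n) :
    c.d i f ∈ (RingHom.ker ψ) ^ k := by
  induction k generalizing f with
  | zero => simp
  | succ k ih =>
    rw [pow_succ] at hf
    induction hf using Submodule.mul_induction_on' with
    | mem_mul_mem a ha b hb =>
      rw [Derivation.leibniz]
      refine Ideal.add_mem _ (Ideal.mul_mem_right _ _ ha) ?_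
      rw [smul_eq_mul, mul_comm, pow_succ]
      exact Ideal.mul_mem_mul (ih ha) hb
    | add a _ b _ ha hb =>
      rw [map_add]
      exact Ideal.add_mem _ ha hb

lemma dWord_mem_pow (w : List (Fin n)) {k : ℕ} {f : A}
    (hf : f ∈ (RingHom.ker ψ) ^ (k + w.length)) : c.dWord w f ∈ (RingHom.ker ψ) ^ k := by
  induction w generalizing f with
  | nil => exact hf
  | cons i w ih => exact ih (c.d_mem_pow ψ hf i)

lemma dWord_mem_ker {k : ℕ} {f : A} (hf : f ∈ (RingHom.ker ψ) ^ (k + 1)) {w : List (Fin n)}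
    (hw : w.length ≤ k) : ψ (c.dWord w f) = 0 := by
  rw [← RingHom.mem_ker, ← pow_one (RingHom.ker ψ)]
  exact c.dWord_mem_pow ψ w (Ideal.pow_le_pow_right (by omega) hf)

variable [CharZero F]

/-- Euler's identity expresses `k * f` through the products `c.d i f * c.u ψ i` modulo `𝔪 ^ (k +
1)`, and `k` is invertible in characteristic zero. -/
lemma mem_pow_succ_of_d_mem {k : ℕ} (hk : k ≠ 0) {f : A} (hf : f ∈ (RingHom.ker ψ) ^ k)
    (h : ∀ i, c.d i f ∈ (RingHom.ker ψ) ^ k) : f ∈ (RingHom.ker ψ) ^ (k + 1) := by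
  have h1 : (k : A) * f ∈ (RingHom.ker ψ) ^ (k + 1) := by
    have h2 := c.euler ψ hf
    have h3 : ∑ i, c.d i f * c.u ψ i ∈ (RingHom.ker ψ) ^ (k + 1) :=
      Ideal.sum_mem _ fun i _ => by
        rw [pow_succ]
        exact Ideal.mul_mem_mul (h i) (c.u_mem ψ i)
    simpa using Ideal.add_mem _ h2 h3
  have h4 : f = algebraMap F A (k : F)⁻¹ * ((k : A) * f) := by
    rw [← mul_assoc, ← map_natCast (algebraMap F A) k, ← map_mul,
      inv_mul_cancel₀ (Nat.cast_ne_zero.2 hk), map_one, one_mul]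
  rw [h4]
  exact Ideal.mul_mem_left _ _ h1

/-- A function vanishes at a point to the order `k` iff its derivatives up to that order do. -/
lemma mem_pow_succ_iff {k : ℕ} {f : A} : f ∈ (RingHom.ker ψ) ^ (k + 1) ↔
    ∀ w : List (Fin n), w.length ≤ k → ψ (c.dWord w f) = 0 := by
  refine ⟨fun hf w hw => c.dWord_mem_ker ψ hf hw, fun h => ?_⟩
  induction k generalizing f with
  | zero =>
    rw [zero_add, pow_one]
    exact h [] le_rfl
  | succ k ih =>
    refine c.mem_pow_succ_of_d_mem ψ k.succ_ne_zero (ih fun w hw => h w (hw.trans k.le_succ)) ?_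
    exact fun i => ih fun w hw => h (i :: w) (Nat.succ_le_succ hw)

omit [CharZero F] in
lemma dWord_replicate_u_pow {k : ℕ} (j l : Fin n) (m : ℕ) :
    c.dWord (List.replicate k j) (c.u ψ l ^ m) =
      if l = j then (m.descFactorial k : A) * c.u ψ l ^ (m - k) else
        if k = 0 then c.u ψ l ^ m else 0 := by
  induction k generalizing m with
  | zero => simp
  | succ k ih =>
    rw [List.replicate_succ, dWord_cons, Derivation.leibniz_pow, c.d_u]
    by_cases h : l = j
    · have : (m • c.u ψ l ^ (m - 1) • (1 : A)) = (m : F) • c.u ψ l ^ (m - 1) := by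
        rw [smul_eq_mul, mul_one, Nat.cast_smul_eq_nsmul]
      rw [if_pos h, this, map_smul, ih, if_pos h]
      have e : m * (m - 1).descFactorial k = m.descFactorial (k + 1) := by
        cases m with
        | zero => simp
        | succ m => rw [Nat.succ_descFactorial_succ]; rfl
      rw [Nat.cast_smul_eq_nsmul, nsmul_eq_mul, ← mul_assoc, ← Nat.cast_mul, e, Nat.sub_sub,
        add_comm 1 k, if_pos h]
    · simp [h]

end Point

end LocalCoordinates

/-! ### Polynomials of bounded degree -/

namespace MvPolynomial

variable {σ F : Type*} [Field F]

theorem eq_C_of_pderiv_eq_zero [CharZero F] {p : MvPolynomial σ F} (h : ∀ i, pderiv i p = 0) :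
    p = C (coeff 0 p) := by
  classical
  ext m
  rw [coeff_C]
  split_ifs with hm
  · rw [hm]
  · obtain ⟨i, hi⟩ : ∃ i, m i ≠ 0 := by
      by_contra! h0
      exact hm (Finsupp.ext fun i => (h0 i).symm)
    have h1 := coeff_pderiv (i := i) p (m - Finsupp.single i 1)
    rw [h, coeff_zero, tsub_add_cancel_of_le (by simpa using Nat.one_le_iff_ne_zero.2 hi)] at h1
    rcases mul_eq_zero.1 h1.symm with h2 | h2
    · exact h2
    · exact absurd h2 (Nat.cast_add_one_ne_zero _)

theorem totalDegree_pderiv_le {p : MvPolynomial σ F} {k : ℕ} (hp : p.totalDegree ≤ k + 1) (i : σ) :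
    (pderiv i p).totalDegree ≤ k := by
  classical
  refine Finset.sup_le fun m hm => ?_
  rw [mem_support_iff, coeff_pderiv] at hm
  have h := (le_totalDegree (mem_support_iff.2 (left_ne_zero_of_mul hm))).trans hp
  rw [Finsupp.sum_add_index' (by simp) (by simp), Finsupp.sum_single_index rfl] at h
  exact Nat.le_of_succ_le_succ h

/-- The exponents of degree at most `k` in `n` variables are the exponents of degree `k` in `n + 1`
variables. -/
noncomputable def degreeLEEquiv (n k : ℕ) : {s : Fin n →₀ ℕ // (s.sum fun _ e => e) ≤ k} ≃
    {P : Fin (n + 1) →₀ ℕ // (P.sum fun _ => id) = k} where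
  toFun s := ⟨s.1.cons (k - s.1.sum fun _ e => e), by
    change Finsupp.sum _ (fun _ e => e) = k
    rw [Finsupp.sum_cons]
    exact Nat.sub_add_cancel s.2⟩
  invFun P := ⟨P.1.tail, by
    have h : P.1.sum (fun _ e => e) = k := P.2
    rw [← Finsupp.cons_tail P.1, Finsupp.sum_cons] at h
    exact (Nat.le_add_left _ _).trans h.le⟩
  left_inv s := Subtype.ext (Finsupp.tail_cons _ _)
  right_inv P := by
    refine Subtype.ext ?_
    have h : P.1.sum (fun _ e => e) = k := P.2
    rw [← Finsupp.cons_tail P.1, Finsupp.sum_cons] at h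
    conv_rhs => rw [← Finsupp.cons_tail P.1]
    change Finsupp.cons (k - P.1.tail.sum fun _ e => e) P.1.tail = _
    congr 1
    exact Nat.sub_eq_of_eq_add h.symm

/-- Homogenization turns the monomials of degree at most `k` into multisets of size `k` on `n + 1`
letters, which are then counted. -/
theorem finrank_restrictTotalDegree (n k : ℕ) :
    Module.finrank F (restrictTotalDegree (Fin n) F k) = (n + k).choose k := by
  let b : Module.Basis {s : Fin n →₀ ℕ // (s.sum fun _ e => e) ≤ k} F
    (restrictTotalDegree (Fin n) F k) := basisRestrictSupport F _
  rw [Module.finrank_eq_nat_card_basis b,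
    Nat.card_congr ((degreeLEEquiv n k).trans (Sym.equivNatSum _ k).symm),
    Nat.card_eq_fintype_card, Sym.card_sym_eq_choose]
  simp [add_right_comm]

end MvPolynomial

/-! ### Taylor polynomials and the dimension of jet spaces -/

namespace LocalCoordinates

variable {F A : Type} [Field F] [CharZero F] [CommRing A] [Algebra F A] {n : ℕ}
  (c : LocalCoordinates F A n)

open MvPolynomial in
omit [CharZero F] in
lemma d_aeval {v : Fin n → A} (hv : ∀ i j, c.d i (v j) = if j = i then 1 else 0) (i : Fin n)
    (p : MvPolynomial (Fin n) F) : c.d i (aeval v p) = aeval v (pderiv i p) := by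
  induction p using MvPolynomial.induction_on with
  | C a => simp
  | add p q hp hq => simp only [map_add, hp, hq]
  | mul_X p j hp =>
    rw [map_mul, Derivation.leibniz, hp, aeval_X, hv, Derivation.leibniz, pderiv_X, map_add,
      smul_eq_mul, smul_eq_mul, smul_eq_mul, smul_eq_mul, map_mul, map_mul, aeval_X]
    congr 2
    rcases eq_or_ne j i with h | h
    · simp [h]
    · simp [h]

open MvPolynomial in
-- Induction on the degree: a partial derivative lowers both the degree and the order of vanishing
-- by one, so all partial derivatives of `p` are zero. Then `p` is a constant that vanishes at the
-- point.
lemma eq_zero_of_aeval_u_mem (ψ : A →ₐ[F] F) {k : ℕ} {p : MvPolynomial (Fin n) F}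
    (hp : p.totalDegree ≤ k) (h : aeval (c.u ψ) p ∈ (RingHom.ker ψ) ^ (k + 1)) : p = 0 := by
  have key (q : MvPolynomial (Fin n) F) (k : ℕ)
      (h : aeval (c.u ψ) q ∈ (RingHom.ker ψ) ^ (k + 1)) (hq : ∀ i, pderiv i q = 0) : q = 0 := by
    rw [eq_C_of_pderiv_eq_zero hq, aeval_C] at h
    have h1 := Ideal.pow_le_self k.succ_ne_zero h
    rw [RingHom.mem_ker, AlgHom.commutes] at h1
    rw [eq_C_of_pderiv_eq_zero hq, show coeff 0 q = 0 from h1, C_0]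
  induction k generalizing p with
  | zero =>
    refine key p 0 h fun i => ?_
    rw [totalDegree_eq_zero_iff_eq_C.1 (Nat.le_zero.1 hp), pderiv_C]
  | succ k ih =>
    refine key p _ h fun i => ih (totalDegree_pderiv_le hp i) ?_
    rw [← c.d_aeval (c.d_u ψ)]
    exact c.d_mem_pow ψ h i

open MvPolynomial in
omit [CharZero F] in
-- Multiplicativity reduces to factors in `𝔪`, each of which is linear in the `u i` modulo `𝔪 ^ 2`
-- by `taylor_one`. This supplies the next term of the Taylor expansion.
lemma exists_aeval_u_of_mem_pow (ψ : A →ₐ[F] F) {k : ℕ} {f : A} (hf : f ∈ (RingHom.ker ψ) ^ k) :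
    ∃ p : MvPolynomial (Fin n) F, p.totalDegree ≤ k ∧ aeval (c.u ψ) p ∈ (RingHom.ker ψ) ^ k ∧
      f - aeval (c.u ψ) p ∈ (RingHom.ker ψ) ^ (k + 1) := by
  induction k generalizing f with
  | zero =>
    refine ⟨C (ψ f), by simp, by simp, ?_⟩
    rw [zero_add, pow_one, aeval_C]
    exact sub_mem_ker ψ f
  | succ k ih =>
    rw [pow_succ] at hf
    induction hf using Submodule.mul_induction_on' with
    | mem_mul_mem a ha b hb =>
      obtain ⟨p, hp, hp', hpa⟩ := ih ha
      let q : MvPolynomial (Fin n) F := ∑ i, C (ψ (c.d i b)) * X i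
      have hq : aeval (c.u ψ) q = ∑ i, algebraMap F A (ψ (c.d i b)) * c.u ψ i := by simp [q]
      have hq1 : aeval (c.u ψ) q ∈ RingHom.ker ψ := by
        rw [hq]
        exact Ideal.sum_mem _ fun i _ => Ideal.mul_mem_left _ _ (c.u_mem ψ i)
      have hqb : b - aeval (c.u ψ) q ∈ (RingHom.ker ψ) ^ 2 := by
        have h1 : ∑ i, (c.d i b - algebraMap F A (ψ (c.d i b))) * c.u ψ i ∈ (RingHom.ker ψ) ^ 2 := by
          refine Ideal.sum_mem _ fun i _ => ?_
          rw [pow_two]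
          exact Ideal.mul_mem_mul (sub_mem_ker ψ _) (c.u_mem ψ i)
        convert Ideal.add_mem _ (c.taylor_one ψ hb) h1 using 1
        rw [hq]
        simp only [sub_mul, Finset.sum_sub_distrib]
        ring
      refine ⟨p * q, ?_, ?_, ?_⟩
      · refine (totalDegree_mul _ _).trans (Nat.add_le_add hp ?_)
        refine totalDegree_finsetSum_le fun i _ => ?_
        refine (totalDegree_mul _ _).trans ?_
        rw [totalDegree_C, totalDegree_X]
      · rw [map_mul, pow_succ]
        exact Ideal.mul_mem_mul hp' hq1
      · have h1 := Ideal.mul_mem_mul ha hqb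
        have h2 := Ideal.mul_mem_mul hpa hq1
        rw [← pow_add] at h1
        rw [← pow_succ] at h2
        convert Ideal.add_mem _ h1 h2 using 1
        rw [map_mul]
        ring
    | add a _ b _ ha hb =>
      obtain ⟨p, hp, hp', hpa⟩ := ha
      obtain ⟨q, hq, hq', hqb⟩ := hb
      refine ⟨p + q, (totalDegree_add _ _).trans (max_le hp hq), ?_, ?_⟩
      · rw [map_add]
        exact Ideal.add_mem _ hp' hq'
      · convert Ideal.add_mem _ hpa hqb using 1
        rw [map_add]
        ring

open MvPolynomial in
omit [CharZero F] in
/-- Taylor expansion at a point. -/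
lemma exists_taylor (ψ : A →ₐ[F] F) (k : ℕ) (f : A) : ∃ p : MvPolynomial (Fin n) F,
    p.totalDegree ≤ k ∧ f - aeval (c.u ψ) p ∈ (RingHom.ker ψ) ^ (k + 1) := by
  induction k with
  | zero =>
    obtain ⟨p, hp, -, h⟩ := c.exists_aeval_u_of_mem_pow ψ (k := 0) (f := f) (by simp)
    exact ⟨p, hp, h⟩
  | succ k ih =>
    obtain ⟨p, hp, h⟩ := ih
    obtain ⟨q, hq, -, h'⟩ := c.exists_aeval_u_of_mem_pow ψ h
    refine ⟨p + q, (totalDegree_add _ _).trans (max_le (hp.trans k.le_succ) hq), ?_⟩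
    rwa [map_add, ← sub_sub]

open MvPolynomial in
/-- The space of `k`-jets of functions at a point is the space of polynomials of
degree at most `k`. -/
noncomputable def jetEquiv (ψ : A →ₐ[F] F) (k : ℕ) :
    restrictTotalDegree (Fin n) F k ≃ₗ[F] A ⧸ (RingHom.ker ψ) ^ (k + 1) :=
  LinearEquiv.ofBijective
    ((Ideal.Quotient.mkₐ F _).toLinearMap ∘ₗ (aeval (c.u ψ)).toLinearMap ∘ₗ Submodule.subtype _) <| by
    constructor
    · rw [injective_iff_map_eq_zero]
      intro p hp
      refine Subtype.ext (c.eq_zero_of_aeval_u_mem ψ ((mem_restrictTotalDegree _ _ _).1 p.2) ?_)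
      exact Ideal.Quotient.eq_zero_iff_mem.1 hp
    · intro a
      obtain ⟨a, rfl⟩ := Ideal.Quotient.mk_surjective a
      obtain ⟨p, hp, h⟩ := c.exists_taylor ψ k a
      refine ⟨⟨p, (mem_restrictTotalDegree _ _ _).2 hp⟩, ?_⟩
      exact (Ideal.Quotient.eq.2 h).symm

include c in
lemma finrank_quotient (ψ : A →ₐ[F] F) (k : ℕ) :
    Module.finrank F (A ⧸ (RingHom.ker ψ) ^ (k + 1)) = (n + k).choose k := by
  rw [← (c.jetEquiv ψ k).finrank_eq, MvPolynomial.finrank_restrictTotalDegree]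

include c in
lemma finite_quotient (ψ : A →ₐ[F] F) (k : ℕ) :
    Module.Finite F (A ⧸ (RingHom.ker ψ) ^ (k + 1)) :=
  Module.Finite.equiv (c.jetEquiv ψ k)

open MvPolynomial in
lemma algebraicIndependent_t [Nontrivial A] : AlgebraicIndependent F c.t := by
  rw [algebraicIndependent_iff]
  have key (k : ℕ) : ∀ p : MvPolynomial (Fin n) F, p.totalDegree ≤ k → aeval c.t p = 0 → p = 0 := by
    have (q : MvPolynomial (Fin n) F) (h : aeval c.t q = 0) (hq : ∀ i, pderiv i q = 0) :
        q = 0 := by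
      rw [eq_C_of_pderiv_eq_zero hq, aeval_C, map_eq_zero] at h
      rw [eq_C_of_pderiv_eq_zero hq, h, C_0]
    induction k with
    | zero =>
      intro p hp h
      refine this p h fun i => ?_
      rw [totalDegree_eq_zero_iff_eq_C.1 (Nat.le_zero.1 hp), pderiv_C]
    | succ k ih =>
      intro p hp h
      refine this p h fun i => ih _ (totalDegree_pderiv_le hp i) ?_
      rw [← c.d_aeval c.d_t, h, map_zero]
  exact fun p => key _ p le_rfl

include c in
-- The coordinates are a transcendence basis: a derivation that kills them is zero by the chain
-- rule, so `A` is algebraic over the subalgebra that they generate.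
lemma trdeg_eq [IsDomain A] [Algebra.FiniteType F A] : Algebra.trdeg F A = n := by
  have : Algebra.IsAlgebraic (Algebra.adjoin F (Set.range c.t)) A := by
    refine isAlgebraic_of_derivation_eq_zero _ fun D hD => ?_
    ext a
    rw [c.derivation_apply D]
    refine Finset.sum_eq_zero fun i _ => ?_
    rw [hD _ (Algebra.subset_adjoin ⟨i, rfl⟩), smul_zero]
  have h := c.algebraicIndependent_t.isTranscendenceBasis_iff_isAlgebraic.2 this
  rw [← h.cardinalMk_eq_trdeg]
  simp

end LocalCoordinates

/-! ### Linear algebra and the Nullstellensatz -/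

theorem Matrix.exists_det_apply_ne_zero {F V ι κ : Type*} [Field F] [AddCommGroup V] [Module F V]
    [Module.Finite F V] {N : ℕ} (hN : Module.finrank F V = N) (x : ι → V)
    (hx : ⊤ ≤ Submodule.span F (Set.range x)) (l : κ → Module.Dual F V)
    (hl : ∀ v, (∀ j, l j v = 0) → v = 0) :
    ∃ (e : Fin N → ι) (w : Fin N → κ), Function.Injective e ∧
      (Matrix.of fun a b => l (w a) (x (e b))).det ≠ 0 := by
  -- A basis of `V` is extracted from `x` and one of the dual from `l`; the pairing matrix of two
  -- such bases is invertible.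
  obtain ⟨ι', e, he, hspan, hli⟩ := exists_linearIndependent' F x
  obtain ⟨κ', w, -, hspan', hli'⟩ := exists_linearIndependent' F l
  let b := Module.Basis.mk hli (hx.trans hspan.ge)
  -- A family of functionals that separates the vectors spans the dual, in finite dimension.
  have hl' : ⊤ ≤ Submodule.span F (Set.range l) := by
    have h0 : (Submodule.span F (Set.range l)).dualCoannihilator = ⊥ :=
      (Submodule.eq_bot_iff _).2 fun v hv => hl v fun j =>
        (Submodule.mem_dualCoannihilator v).1 hv _ (Submodule.subset_span ⟨j, rfl⟩)
    rw [← Subspace.dualCoannihilator_dualAnnihilator_eq (W := Submodule.span F (Set.range l)), h0,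
      Submodule.dualAnnihilator_bot]
  let b' := Module.Basis.mk hli' (hl'.trans hspan'.ge)
  have := Module.Finite.finite_basis b
  have := Module.Finite.finite_basis b'
  have hb : Nat.card ι' = N := by rw [← hN, Module.finrank_eq_nat_card_basis b]
  have hb' : Nat.card κ' = N := by
    rw [← hN, ← Subspace.dual_finrank_eq, Module.finrank_eq_nat_card_basis b']
  let E := (Finite.equivFinOfCardEq hb).symm
  let E' := (Finite.equivFinOfCardEq hb').symm
  refine ⟨e ∘ E, w ∘ E', he.comp E.injective, fun hdet => ?_⟩
  obtain ⟨z, hz, hz0⟩ := Matrix.exists_mulVec_eq_zero_iff.2 hdet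
  have h1 : ∑ a, z a • b (E a) = 0 := by
    refine hl _ fun j => ?_
    have h2 : l j ∈ Submodule.span F (Set.range (l ∘ w)) := hspan' ▸ Submodule.subset_span ⟨j, rfl⟩
    generalize l j = f at h2
    induction h2 using Submodule.span_induction with
    | mem f hf =>
      obtain ⟨a, rfl⟩ := hf
      have h3 := congr_fun hz0 (E'.symm a)
      rw [map_sum]
      simpa [Matrix.mulVec, dotProduct, b, mul_comm] using h3
    | zero => simp
    | add f g _ _ hf hg => rw [LinearMap.add_apply, hf, hg, add_zero]
    | smul r f _ hf => rw [LinearMap.smul_apply, hf, smul_zero]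
  exact hz (funext (Fintype.linearIndependent_iff.1 (b.linearIndependent.comp E E.injective) z h1))

theorem Ideal.exists_algHom_ker_eq {F R : Type*} [Field F] [IsAlgClosed F] [CommRing R]
    [Algebra F R] [Algebra.FiniteType F R] (I : Ideal R) [I.IsMaximal] :
    ∃ χ : R →ₐ[F] F, RingHom.ker χ = I := by
  let _ : Field (R ⧸ I) := Ideal.Quotient.field I
  have : Algebra.FiniteType F (R ⧸ I) := inferInstance
  have : Module.Finite F (R ⧸ I) := finite_of_finite_type_of_isJacobsonRing F (R ⧸ I)
  have : Algebra.IsAlgebraic F (R ⧸ I) := inferInstance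
  let φ : (R ⧸ I) →ₐ[F] F := IsAlgClosed.lift
  refine ⟨φ.comp (Ideal.Quotient.mkₐ F I), ?_⟩
  ext r
  rw [RingHom.mem_ker, AlgHom.comp_apply, map_eq_zero_iff φ φ.toRingHom.injective]
  exact Ideal.Quotient.eq_zero_iff_mem

/-- Over an algebraically closed field, a function on an integral variety that vanishes at all
points is zero. -/
theorem eq_zero_of_forall_algHom_eq_zero {F R : Type*} [Field F] [IsAlgClosed F] [CommRing R]
    [IsDomain R] [Algebra F R] [Algebra.FiniteType F R] {r : R} (h : ∀ χ : R →ₐ[F] F, χ r = 0) :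
    r = 0 := by
  have := isJacobsonRing_of_finiteType (A := F) (B := R)
  have h1 := this.out Ideal.isRadical_bot
  -- In a Jacobson domain zero is the intersection of the maximal ideals, and each of these is the
  -- kernel of a character.
  rw [← Ideal.mem_bot, ← h1, Ideal.jacobson, Ideal.mem_sInf]
  rintro I ⟨-, hI⟩
  obtain ⟨χ, rfl⟩ := I.exists_algHom_ker_eq (F := F)
  exact h χ

/-! ### Jet conditions at a point and pivot minors -/

namespace LocalCoordinates

variable {F A : Type} [Field F] [CharZero F] [CommRing A] [Algebra F A] {n : ℕ}
  (c : LocalCoordinates F A n) {ι : Type} [Fintype ι] (s : ι → A) (k : ℕ)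

/-- The coefficients of the linear combinations of the functions `s i` that vanish at the
point `ψ` to the order `k`. -/
def _root_.jetCone (ψ : A →ₐ[F] F) : Set (ι → F) := {v | ∑ i, v i • s i ∈ (RingHom.ker ψ) ^ (k + 1)}

/-- The functions `s i` span the space of `k`-jets at the point `ψ`. -/
def _root_.SpansJets (ψ : A →ₐ[F] F) : Prop :=
  ∀ a : A, ∃ v : ι → F, a - ∑ i, v i • s i ∈ (RingHom.ker ψ) ^ (k + 1)

variable {s k} in
lemma mem_jetCone_iff {ψ : A →ₐ[F] F} {v : ι → F} : v ∈ jetCone s k ψ ↔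
    ∀ w : List (Fin n), w.length ≤ k → ∑ i, v i * ψ (c.dWord w (s i)) = 0 := by
  rw [jetCone, Set.mem_ofPred_eq, c.mem_pow_succ_iff]
  simp [map_sum]

theorem exists_minor {ψ : A →ₐ[F] F} (h : SpansJets s k ψ) :
    ∃ (e : Fin ((n + k).choose k) → ι) (w : Fin ((n + k).choose k) → List (Fin n)),
      Function.Injective e ∧ (∀ a, (w a).length ≤ k) ∧
      ψ (Matrix.of fun a b => c.dWord (w a) (s (e b))).det ≠ 0 := by
  have := c.finite_quotient ψ k
  let I := RingHom.ker ψ ^ (k + 1)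
  let E := Submodule.Quotient.restrictScalarsEquiv F I
  -- The derivatives of order at most `k` at the point are functionals on the jet space, and they
  -- separate jets by `mem_pow_succ_iff`.
  let l (w : {w : List (Fin n) // w.length ≤ k}) : Module.Dual F (A ⧸ I) :=
    (I.restrictScalars F).liftQ (ψ.toLinearMap ∘ₗ c.dWord w.1)
      (fun a ha => c.dWord_mem_ker ψ ha w.2) ∘ₗ E.symm.toLinearMap
  have hl (w) (a : A) : l w (Ideal.Quotient.mk I a) = ψ (c.dWord w.1 a) := rfl
  have hspan : ⊤ ≤ Submodule.span F (Set.range fun i => Ideal.Quotient.mk I (s i)) := by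
    rintro a -
    obtain ⟨a, rfl⟩ := Ideal.Quotient.mk_surjective a
    obtain ⟨v, hv⟩ := h a
    rw [Ideal.Quotient.eq.2 hv, map_sum]
    refine Submodule.sum_mem _ fun i _ => ?_
    exact Submodule.smul_mem (Submodule.span F (Set.range fun i => Ideal.Quotient.mk I (s i))) (v i)
      (Submodule.subset_span ⟨i, rfl⟩)
  have hker (a : A ⧸ I) (ha : ∀ w, l w a = 0) : a = 0 := by
    obtain ⟨a, rfl⟩ := Ideal.Quotient.mk_surjective a
    refine Ideal.Quotient.eq_zero_iff_mem.2 ((c.mem_pow_succ_iff ψ).2 fun w hw => ?_)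
    exact ha ⟨w, hw⟩
  obtain ⟨e, w, he, hdet⟩ :=
    Matrix.exists_det_apply_ne_zero (c.finrank_quotient ψ k) _ hspan l hker
  refine ⟨e, fun a => (w a).1, he, fun a => (w a).2, ?_⟩
  rw [AlgHom.map_det]
  exact hdet

end LocalCoordinates

/-! ### The universal section with vanishing jets -/

namespace LocalCoordinates

variable {F A : Type} [Field F] [CharZero F] [CommRing A] [Algebra F A] {n : ℕ}
  (c : LocalCoordinates F A n) {ι : Type} [Fintype ι] [DecidableEq ι] (s : ι → A) (k : ℕ) {N : ℕ}
  (e : Fin N → ι) (w : Fin N → List (Fin n))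

/-- A square matrix of derivatives of the functions `s i`. -/
noncomputable def minor : Matrix (Fin N) (Fin N) A := Matrix.of fun a b => c.dWord (w a) (s (e b))

/-- The coordinate ring of the total space of the bundle of the linear combinations that vanish to
the order `k`, where the latter are parametrized by their coefficients outside a set of pivots. -/
abbrev TotalRing (A : Type) [CommRing A] {ι : Type} {N : ℕ} (e : Fin N → ι) : Type :=
  MvPolynomial {i // i ∉ Set.range e} A

open Classical in
/-- The free coefficients. -/
noncomputable def freeCoeff (i : ι) : TotalRing A e :=
  if h : i ∉ Set.range e then MvPolynomial.X ⟨i, h⟩ else 0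

/-- The derivatives of the linear combination with the free coefficients. -/
noncomputable def freePart (a : Fin N) : TotalRing A e :=
  ∑ i, MvPolynomial.C (c.dWord (w a) (s i)) * freeCoeff e i

/-- The coefficients of the universal linear combination that vanishes to the order `k`. -/
noncomputable def universalCoeff (i : ι) : TotalRing A e :=
  -- Cramer's rule cleared of denominators: the free coefficients are scaled by the minor, and the
  -- pivot ones are minus the adjugate applied to the free part.
  MvPolynomial.C (c.minor s e w).det * freeCoeff e i -
    ∑ b, if e b = i then ((((c.minor s e w).map MvPolynomial.C).adjugate).mulVec
      (c.freePart s e w)) b else 0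

omit [CharZero F] in
lemma sum_universalCoeff (a : Fin N) :
    ∑ i, c.universalCoeff s e w i * MvPolynomial.C (c.dWord (w a) (s i)) = 0 := by
  have h1 : ∑ i, (∑ b, if e b = i then ((((c.minor s e w).map MvPolynomial.C).adjugate).mulVec
      (c.freePart s e w)) b else 0) * MvPolynomial.C (c.dWord (w a) (s i)) =
      (((c.minor s e w).map MvPolynomial.C).mulVec
        ((((c.minor s e w).map MvPolynomial.C).adjugate).mulVec (c.freePart s e w))) a := by
    simp only [Finset.sum_mul, ite_mul, zero_mul]
    rw [Finset.sum_comm]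
    simp only [Finset.sum_ite_eq, Finset.mem_univ, if_true]
    rw [Matrix.mulVec, dotProduct]
    exact Finset.sum_congr rfl fun b _ => mul_comm _ _
  simp only [universalCoeff, sub_mul, Finset.sum_sub_distrib, h1]
  rw [Matrix.mulVec_mulVec, Matrix.mul_adjugate, Matrix.smul_mulVec, Matrix.one_mulVec,
    Pi.smul_apply, ← RingHom.mapMatrix_apply, ← RingHom.map_det, freePart, smul_eq_mul,
    Finset.mul_sum, sub_eq_zero]
  exact Finset.sum_congr rfl fun b _ => by ring

variable {c s k e w}

/-- The point of the base under a point of the total space. -/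
noncomputable def _root_.AlgHom.base {σ : Type} (χ : MvPolynomial σ A →ₐ[F] F) : A →ₐ[F] F :=
  χ.comp (IsScalarTower.toAlgHom F A (MvPolynomial σ A))

omit [CharZero F] in
lemma _root_.AlgHom.base_apply {σ : Type} (χ : MvPolynomial σ A →ₐ[F] F) (a : A) :
    χ.base a = χ (MvPolynomial.C a) := rfl

include c in
omit [DecidableEq ι] in
/-- Over the locus where the pivot minor is invertible, the pivot equations suffice. -/
lemma mem_jetCone_of_minor {w : Fin ((n + k).choose k) → List (Fin n)}
    {e : Fin ((n + k).choose k) → ι}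
    (hw : ∀ a, (w a).length ≤ k) {ψ : A →ₐ[F] F} (hψ : ψ (c.minor s e w).det ≠ 0) {v : ι → F}
    (hv : ∀ a, ∑ i, v i * ψ (c.dWord (w a) (s i)) = 0) : v ∈ jetCone s k ψ := by
  let I := RingHom.ker ψ ^ (k + 1)
  have := c.finite_quotient ψ k
  have hdet (z : Fin ((n + k).choose k) → F)
      (hz : ∀ a, ∑ b, z b * ψ (c.dWord (w a) (s (e b))) = 0) : z = 0 := by
    rw [AlgHom.map_det] at hψ
    refine Matrix.eq_zero_of_mulVec_eq_zero hψ (funext fun a => ?_)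
    exact (Finset.sum_congr rfl fun b _ => mul_comm _ _).trans (hz a)
  have hker {y : A} (hy : y ∈ I) (a) : ψ (c.dWord (w a) y) = 0 := c.dWord_mem_ker ψ hy (hw a)
  -- The pivot sections form a basis of the jet space, their number being its dimension. The pivot
  -- equations then force the coordinates of the given jet in this basis to vanish.
  have hli : LinearIndependent F fun b => Ideal.Quotient.mk I (s (e b)) := by
    rw [Fintype.linearIndependent_iff]
    intro z hz
    refine fun b => congr_fun (hdet z fun a => ?_) b
    have h1 : ∑ b, z b • s (e b) ∈ I := by
      rw [← Ideal.Quotient.eq_zero_iff_mem, ← hz, map_sum]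
      rfl
    simpa [map_sum] using hker h1 a
  have hspan := hli.span_eq_top_of_card_eq_finrank' (by
    rw [Fintype.card_fin, c.finrank_quotient])
  have hmem : Ideal.Quotient.mk I (∑ i, v i • s i) ∈
      Submodule.span F (Set.range fun b => Ideal.Quotient.mk I (s (e b))) :=
    hspan ▸ Submodule.mem_top
  obtain ⟨z, hz⟩ := (Submodule.mem_span_range_iff_exists_fun F).1 hmem
  have h2 : ∑ i, v i • s i - ∑ b, z b • s (e b) ∈ I := by
    rw [← Ideal.Quotient.eq, ← hz, map_sum]
    rfl
  have h3 : z = 0 := hdet z fun a => by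
    have := hker h2 a
    simp only [map_sub, map_sum, map_smul, smul_eq_mul, hv a, zero_sub, neg_eq_zero] at this
    exact this
  rw [jetCone, Set.mem_ofPred_eq]
  simpa [h3] using h2

lemma universalCoeff_mem_jetCone {w : Fin ((n + k).choose k) → List (Fin n)}
    {e : Fin ((n + k).choose k) → ι} (hw : ∀ a, (w a).length ≤ k)
    (χ : TotalRing A e →ₐ[F] F) (hχ : χ.base (c.minor s e w).det ≠ 0) :
    (fun i => χ (c.universalCoeff s e w i)) ∈ jetCone s k χ.base := by
  refine mem_jetCone_of_minor hw hχ fun a => ?_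
  have h := congr_arg χ (c.sum_universalCoeff s e w a)
  simpa [AlgHom.base_apply] using h

/-- Over the locus where the pivot minor is invertible, every linear combination that vanishes to
the order `k` is a specialization of the universal one. -/
lemma exists_universalCoeff_eq (he : Function.Injective e) (hw : ∀ a, (w a).length ≤ k)
    {ψ : A →ₐ[F] F} (hψ : ψ (c.minor s e w).det ≠ 0) {v : ι → F} (hv : v ∈ jetCone s k ψ) :
    ∃ χ : TotalRing A e →ₐ[F] F, χ.base = ψ ∧ ∀ i, χ (c.universalCoeff s e w i) = v i := by
  let g := ψ (c.minor s e w).det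
  let χ : TotalRing A e →ₐ[F] F :=
    -- The factor `g⁻¹` compensates for the minor by which `universalCoeff` scales the free
    -- variables.
    { MvPolynomial.eval₂Hom ψ.toRingHom (fun i : {i // i ∉ Set.range e} => g⁻¹ * v i) with
      commutes' r := by
        simp [MvPolynomial.algebraMap_eq, IsScalarTower.algebraMap_apply F A (TotalRing A e)] }
  have hC (a : A) : χ (MvPolynomial.C a) = ψ a := by simp [χ]
  have hX (i) : χ (MvPolynomial.X i) = g⁻¹ * v i := by simp [χ]
  refine ⟨χ, AlgHom.ext hC, ?_⟩
  have h1 (i : ι) (hi : i ∉ Set.range e) : χ (c.universalCoeff s e w i) = v i := by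
    have : ∀ b, e b ≠ i := fun b hb => hi ⟨b, hb⟩
    rw [universalCoeff, freeCoeff, dif_pos hi, map_sub, map_mul, hC, hX, mul_inv_cancel_left₀ hψ]
    simp [this]
  -- The free coefficients agree, so the differences of the pivot ones solve the homogeneous system
  -- with the invertible pivot matrix.
  have h2 : (fun b => χ (c.universalCoeff s e w (e b)) - v (e b)) = 0 := by
    have hdet := hψ
    rw [AlgHom.map_det] at hdet
    refine Matrix.eq_zero_of_mulVec_eq_zero hdet (funext fun a => ?_)
    have h3 := congr_arg χ (c.sum_universalCoeff s e w a)
    have h4 := (c.mem_jetCone_iff.1 hv) (w a) (hw a)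
    simp only [map_sum, map_mul, hC, map_zero] at h3
    have h5 : ∑ i, (χ (c.universalCoeff s e w i) - v i) * ψ (c.dWord (w a) (s i)) = 0 := by
      simp only [sub_mul, Finset.sum_sub_distrib, h3, h4, sub_zero]
    rw [Pi.zero_apply, ← h5, ← Finset.sum_subset (Finset.subset_univ (Finset.univ.image e)),
      Finset.sum_image (he.injOn)]
    · rw [Matrix.mulVec, dotProduct]
      exact Finset.sum_congr rfl fun b _ => mul_comm _ _
    · intro i _ hi
      rw [h1 i (by simpa using hi), sub_self, zero_mul]
  intro i
  by_cases hi : i ∈ Set.range e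
  · obtain ⟨b, rfl⟩ := hi
    exact sub_eq_zero.1 (congr_fun h2 b)
  · exact h1 i hi

end LocalCoordinates

/-! ### Generic finiteness and the local dimension count -/

namespace LocalCoordinates

variable {F A : Type} [Field F] [CharZero F] [CommRing A] [IsDomain A] [Algebra F A]
  [Algebra.FiniteType F A] {n : ℕ}
  (c : LocalCoordinates F A n) {ι : Type} [Fintype ι] [DecidableEq ι] {s : ι → A} {k : ℕ}
  {e : Fin ((n + k).choose k) → ι} {w : Fin ((n + k).choose k) → List (Fin n)}
  (he : Function.Injective e) (hw : ∀ a, (w a).length ≤ k)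

instance : Algebra.FiniteType F (TotalRing A e) :=
  Algebra.FiniteType.trans (S := A) inferInstance inferInstance

instance : IsScalarTower F A (FractionRing (TotalRing A e)) :=
  .to₁₂₄ F A (TotalRing A e) (FractionRing (TotalRing A e))

/-- The substitution of the universal coefficients. -/
noncomputable def universalHom (s : ι → A) (e : Fin ((n + k).choose k) → ι)
    (w : Fin ((n + k).choose k) → List (Fin n)) :
    MvPolynomial ι F →ₐ[F] TotalRing A e := MvPolynomial.aeval (c.universalCoeff s e w)

omit [CharZero F] [IsDomain A] [Algebra.FiniteType F A] in
lemma apply_universalHom (χ : TotalRing A e →ₐ[F] F) (p : MvPolynomial ι F) :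
    χ (c.universalHom s e w p) = MvPolynomial.eval (fun i => χ (c.universalCoeff s e w i)) p := by
  rw [universalHom, ← AlgHom.comp_apply, MvPolynomial.comp_aeval, MvPolynomial.aeval_eq_eval]

include he hw in
omit [IsDomain A] [Algebra.FiniteType F A] in
lemma eval_eq_zero_of_universalHom_eq_zero {p : MvPolynomial ι F}
    (hp : c.universalHom s e w p = 0) {ψ : A →ₐ[F] F} (hψ : ψ (c.minor s e w).det ≠ 0) {v : ι → F}
    (hv : v ∈ jetCone s k ψ) : MvPolynomial.eval v p = 0 := by
  obtain ⟨χ, -, hχ⟩ := exists_universalCoeff_eq he hw hψ hv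
  rw [← map_zero χ, ← hp, apply_universalHom]
  congr 2
  exact (funext hχ).symm

include hw in
-- By construction only the pivot equations hold identically. The others hold at every point where
-- the minor is nonzero, so their product with the minor vanishes at all points and is zero by the
-- Nullstellensatz.
lemma sum_universalCoeff_dWord_eq_zero [IsAlgClosed F] (hdet : (c.minor s e w).det ≠ 0)
    {w' : List (Fin n)} (hw' : w'.length ≤ k) :
    ∑ i, c.universalCoeff s e w i * MvPolynomial.C (c.dWord w' (s i)) = 0 := by
  have h : MvPolynomial.C (c.minor s e w).det *
      ∑ i, c.universalCoeff s e w i * MvPolynomial.C (c.dWord w' (s i)) = 0 := by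
    refine eq_zero_of_forall_algHom_eq_zero (F := F) fun χ => ?_
    rw [map_mul, ← AlgHom.base_apply]
    by_cases hχ : χ.base (c.minor s e w).det = 0
    · rw [hχ, zero_mul]
    · have := c.mem_jetCone_iff.1 (universalCoeff_mem_jetCone hw χ hχ) w' hw'
      rw [map_sum]
      simp only [map_mul, ← AlgHom.base_apply, this, mul_zero]
  refine (mul_eq_zero.1 h).resolve_left ?_
  rwa [MvPolynomial.C_eq_zero]

include hw in
lemma universalHom_eq_zero_of_eval_eq_zero [IsAlgClosed F] (hdet : (c.minor s e w).det ≠ 0)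
    {p : MvPolynomial ι F} {h : A} (h0 : h ≠ 0)
    (hp : ∀ ψ : A →ₐ[F] F, ψ h ≠ 0 → ∀ v ∈ jetCone s k ψ, MvPolynomial.eval v p = 0) :
    c.universalHom s e w p = 0 := by
  have h1 : MvPolynomial.C ((c.minor s e w).det * h) * c.universalHom s e w p = 0 := by
    refine eq_zero_of_forall_algHom_eq_zero (F := F) fun χ => ?_
    rw [map_mul, ← AlgHom.base_apply, map_mul]
    by_cases hχ : χ.base (c.minor s e w).det = 0
    · rw [hχ, zero_mul, zero_mul]
    by_cases hχ' : χ.base h = 0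
    · rw [hχ', mul_zero, zero_mul]
    rw [apply_universalHom, hp χ.base hχ' _ (universalCoeff_mem_jetCone hw χ hχ), mul_zero]
  refine (mul_eq_zero.1 h1).resolve_left ?_
  rw [MvPolynomial.C_eq_zero]
  exact mul_ne_zero hdet h0

/-- The second fundamental form: the derivatives of order `k + 1` of the universal
linear combination that vanishes to the order `k`. -/
noncomputable def leadingForm (s : ι → A) (e : Fin ((n + k).choose k) → ι)
    (w : Fin ((n + k).choose k) → List (Fin n)) :
    Matrix (Fin n) (Fin n) (TotalRing A e) :=
  Matrix.of fun j l => ∑ i, c.universalCoeff s e w i *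
    MvPolynomial.C (c.d l (c.dWord (List.replicate k j) (s i)))

include he hw in
omit [IsDomain A] [Algebra.FiniteType F A] in
/-- If the sections span the jets of order `k + 1`, then some section has the nondegenerate leading
form `∑ j, u j ^ (k + 1)`. -/
lemma det_leadingForm_ne_zero (hk : 1 ≤ k) {ψ : A →ₐ[F] F} (hs : SpansJets s (k + 1) ψ)
    (hψ : ψ (c.minor s e w).det ≠ 0) : (c.leadingForm s e w).det ≠ 0 := by
  obtain ⟨v, hv⟩ := hs (∑ l, c.u ψ l ^ (k + 1))
  have hv' : v ∈ jetCone s k ψ := by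
    have h1 : ∑ l, c.u ψ l ^ (k + 1) ∈ (RingHom.ker ψ) ^ (k + 1) :=
      Ideal.sum_mem _ fun l _ => Ideal.pow_mem_pow (c.u_mem ψ l) _
    have h2 := Ideal.sub_mem _ h1 (Ideal.pow_le_pow_right (k + 1).le_succ hv)
    rwa [sub_sub_cancel] at h2
  obtain ⟨χ, rfl, hχ⟩ := exists_universalCoeff_eq he hw hψ hv'
  intro h0
  have h1 : χ.mapMatrix (c.leadingForm s e w) = Matrix.diagonal fun _ => ((k + 1).factorial : F) := by
    ext j l
    have h2 : χ (c.leadingForm s e w j l) =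
        χ.base (c.d l (c.dWord (List.replicate k j) (∑ i, v i • s i))) := by
      simp [leadingForm, map_sum, hχ, ← AlgHom.base_apply]
    have h3 := c.dWord_mem_ker χ.base hv (w := List.replicate k j ++ [l]) (by simp)
    rw [map_sub, map_sub, sub_eq_zero, dWord_append_singleton, dWord_append_singleton] at h3
    rw [AlgHom.mapMatrix_apply, Matrix.map_apply, h2, ← h3, map_sum]
    -- As `k ≠ 0`, the operator `∂_j^k` kills the powers of `u l` for `l ≠ j`; this makes the matrix
    -- diagonal.
    simp only [c.dWord_replicate_u_pow, Nat.one_le_iff_ne_zero.1 hk, if_false]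
    rw [Finset.sum_ite_eq' , if_pos (Finset.mem_univ _), Nat.add_sub_cancel_left, pow_one,
      Derivation.leibniz, Derivation.map_natCast, smul_zero, add_zero, c.d_u,
      Matrix.diagonal_apply]
    have h4 : (k + 1).descFactorial k = (k + 1).factorial := by
      rw [← Nat.factorial_mul_descFactorial k.le_succ]
      simp
    rw [h4]
    split_ifs <;> simp
  have h2 := congr_arg χ h0
  rw [AlgHom.map_det, h1, Matrix.det_diagonal, map_zero, Finset.prod_const] at h2
  exact pow_ne_zero _ (Nat.cast_ne_zero.2 (Nat.factorial_ne_zero _)) h2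

include he hw in
/-- The projection from the total space is generically finite. -/
lemma isAlgebraic_range_universalHom [IsAlgClosed F] (hk : 1 ≤ k) {ψ : A →ₐ[F] F}
    (hs : SpansJets s (k + 1) ψ) (hψ : ψ (c.minor s e w).det ≠ 0) :
    Algebra.IsAlgebraic (c.universalHom s e w).range (TotalRing A e) := by
  have hdet : (c.minor s e w).det ≠ 0 := fun h => hψ (by rw [h, map_zero])
  refine isAlgebraic_of_derivation_eq_zero _ fun D hD => ?_
  let K := FractionRing (TotalRing A e)
  let δ : Derivation F A K := D.compAlgebraMap A
  have hδ (a : A) : D (MvPolynomial.C a) = δ a := rfl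
  have hc (i : ι) : D (c.universalCoeff s e w i) = 0 :=
    hD _ ⟨MvPolynomial.X i, MvPolynomial.aeval_X _ _⟩
  -- Differentiating the equations of the words `j, ..., j` of length `k` gives a linear system for
  -- the `δ (c.t l)` with matrix `leadingForm`.
  have hδt : (fun l => δ (c.t l)) = 0 := by
    have h1 : ((c.leadingForm s e w).map (algebraMap (TotalRing A e) K)).det ≠ 0 := by
      rw [← RingHom.mapMatrix_apply, ← RingHom.map_det, Ne,
        map_eq_zero_iff _ (IsFractionRing.injective (TotalRing A e) K)]
      exact c.det_leadingForm_ne_zero he hw hk hs hψ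
    refine Matrix.eq_zero_of_mulVec_eq_zero h1 (funext fun j => ?_)
    have h2 := congr_arg D (c.sum_universalCoeff_dWord_eq_zero hw hdet
      (w' := List.replicate k j) (by simp))
    rw [map_zero, map_sum] at h2
    refine Eq.trans ?_ h2
    have h3 (i : ι) (a : A) : D (c.universalCoeff s e w i * MvPolynomial.C a) =
        ∑ l, c.universalCoeff s e w i • c.d l a • δ (c.t l) := by
      rw [Derivation.leibniz, hc, smul_zero, add_zero, hδ, c.derivation_apply δ, Finset.smul_sum]
    simp only [h3]
    rw [Finset.sum_comm, Matrix.mulVec, dotProduct]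
    refine Finset.sum_congr rfl fun l _ => ?_
    simp only [Matrix.map_apply, leadingForm, Matrix.of_apply, map_sum, Finset.sum_mul, map_mul]
    refine Finset.sum_congr rfl fun i _ => ?_
    rw [Algebra.smul_def, Algebra.smul_def, mul_assoc]
    rfl
  have hδ0 (a : A) : δ a = 0 := by
    rw [c.derivation_apply δ]
    exact Finset.sum_eq_zero fun i _ => by rw [congr_fun hδt i, Pi.zero_apply, smul_zero]
  -- A free universal coefficient is the minor times a variable, and `D` now kills the minor.
  have hX (i : {i // i ∉ Set.range e}) : D (MvPolynomial.X i) = 0 := by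
    have h1 := hc i
    have : ∀ b, e b ≠ i := fun b hb => i.2 ⟨b, hb⟩
    rw [universalCoeff, freeCoeff, dif_pos i.2] at h1
    simp only [this, if_false, Finset.sum_const_zero, sub_zero, Derivation.leibniz, hδ, hδ0,
      smul_zero, add_zero] at h1
    rw [Algebra.smul_def] at h1
    refine (mul_eq_zero.1 h1).resolve_left ?_
    rw [map_eq_zero_iff _ (IsFractionRing.injective (TotalRing A e) K)]
    rwa [MvPolynomial.C_eq_zero]
  ext p
  induction p using MvPolynomial.induction_on with
  | C a => exact hδ0 a
  | add p q hp hq => rw [map_add, hp, hq, map_add]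
  | mul_X p j hp => rw [Derivation.leibniz, hX, hp]; simp

include he hw in
/-- The dimension of the closure of the union of the cones. -/
lemma ringKrullDim_quotient_ker [IsAlgClosed F] (hk : 1 ≤ k) {ψ : A →ₐ[F] F}
    (hs : SpansJets s (k + 1) ψ) (hψ : ψ (c.minor s e w).det ≠ 0) :
    ∃ d : ℕ, ringKrullDim (MvPolynomial ι F ⧸ RingHom.ker (c.universalHom s e w)) = d ∧
      d + (n + k).choose k = n + Fintype.card ι := by
  have := c.isAlgebraic_range_universalHom he hw hk hs hψ
  have : Algebra.FiniteType F (c.universalHom s e w).range :=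
    .of_surjective (c.universalHom s e w).rangeRestrict (c.universalHom s e w).rangeRestrict_surjective
  obtain ⟨d, hd, hd'⟩ := ringKrullDim_eq_trdeg (F := F) (R := (c.universalHom s e w).range)
  refine ⟨d, ?_, ?_⟩
  · rw [← hd]
    exact ringKrullDim_eq_of_ringEquiv
      (Ideal.quotientKerEquivRange (c.universalHom s e w)).toRingEquiv
  -- The total ring has transcendence degree `n` plus the number of free variables.
  · rw [trdeg_eq_of_isAlgebraic, ← trdeg_add_eq F A (A := TotalRing A e), c.trdeg_eq,
      MvPolynomial.trdeg_of_isDomain] at hd'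
    have h1 : Fintype.card {i // i ∉ Set.range e} = Fintype.card ι - (n + k).choose k := by
      rw [Fintype.card_subtype_compl, Set.card_range_of_injective he, Fintype.card_fin]
    have h2 : (n + k).choose k ≤ Fintype.card ι := by
      simpa using Fintype.card_le_of_injective e he
    rw [Cardinal.mk_fintype, h1, Cardinal.lift_natCast] at hd'
    have : n + (Fintype.card ι - (n + k).choose k) = d := by exact_mod_cast hd'
    omega

end LocalCoordinates

/-! ### Local generators of a line bundle -/

namespace HigherDual

/-- A section `σ` of `L` over `U` generates `L` over `U`. -/
def IsGenerator {X : Scheme.{0}} {L : X.Modules} {U : X.Opens} (σ : Γ(L, U)) : Prop :=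
  ∀ (V : X.Opens) (h : V ≤ U),
    Function.Bijective fun a : Γ(X, V) => a • L.presheaf.map (homOfLE h).op σ

/-- The generator is the image of `1` under a local trivialization; linearity and naturality carry
this to every smaller open subset. -/
lemma exists_isGenerator {X : Scheme.{0}} (L : X.Modules) [IsLineBundle L] (x : X) :
    ∃ U : X.Opens, x ∈ U ∧ ∃ σ : Γ(L, U), IsGenerator σ := by
  obtain ⟨U, hx, ⟨φ⟩⟩ := IsLineBundle.exists_trivialization (L := L) x
  let M : U.toScheme.Modules := SheafOfModules.unit U.toScheme.ringCatSheaf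
  let φ' : M ⟶ L.restrict U.ι := φ.inv
  let σ : Γ(L, U.ι ''ᵁ ⊤) := φ'.app ⊤ (1 : Γ(U.toScheme, ⊤))
  refine ⟨U.ι ''ᵁ ⊤, ⟨⟨x, hx⟩, trivial, rfl⟩, σ, fun V hV => ?_⟩
  obtain ⟨W, rfl⟩ : ∃ W : U.toScheme.Opens, V = U.ι ''ᵁ W := by
    refine ⟨U.ι ⁻¹ᵁ V, ?_⟩
    rw [Scheme.Hom.image_preimage_eq_opensRange_inf, Scheme.Opens.opensRange_ι, right_eq_inf]
    simpa using hV
  have h1 : φ'.app W (1 : Γ(U.toScheme, W)) = L.presheaf.map (homOfLE hV).op σ := by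
    have h2 := ConcreteCategory.congr_hom (φ'.mapPresheaf.naturality (homOfLE (le_top (a := W))).op)
      (1 : Γ(U.toScheme, ⊤))
    have h3 : M.presheaf.map (homOfLE (le_top (a := W))).op (1 : Γ(U.toScheme, ⊤)) =
      (1 : Γ(U.toScheme, W)) := map_one (U.toScheme.presheaf.map (homOfLE (le_top (a := W))).op).hom
    have h4 : φ'.app W (M.presheaf.map (homOfLE (le_top (a := W))).op (1 : Γ(U.toScheme, ⊤))) =
        L.presheaf.map (homOfLE hV).op σ := h2
    rwa [h3] at h4
  have h5 (a : Γ(X, U.ι ''ᵁ W)) : φ'.app W ((U.ι.appIso W).hom a : Γ(U.toScheme, W)) =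
      a • L.presheaf.map (homOfLE hV).op σ := by
    have h6 := Scheme.Modules.Hom.app_smul φ' ((U.ι.appIso W).hom a) (1 : Γ(U.toScheme, W))
    have h7 : (((U.ι.appIso W).hom a) • (show Γ(M, W) from (1 : Γ(U.toScheme, W)))) =
      (U.ι.appIso W).hom a := mul_one (M := Γ(U.toScheme, W)) _
    have h8 : ((U.ι.appIso W).hom a) • (φ'.app W (1 : Γ(U.toScheme, W))) =
      (show Γ(L, U.ι ''ᵁ W) from
        a • (show Γ(L, U.ι ''ᵁ W) from φ'.app W (1 : Γ(U.toScheme, W)))) := by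
      change ((U.ι.appIso W).inv ((U.ι.appIso W).hom a)) •
        (show Γ(L, U.ι ''ᵁ W) from φ'.app W (1 : Γ(U.toScheme, W))) = _
      rw [Iso.hom_inv_id_apply]
    rw [← h1]
    exact ((congrArg (φ'.app W) h7).symm.trans h6).trans h8
  have h9 : Function.Bijective (φ'.app W) :=
    ConcreteCategory.bijective_of_isIso (φ'.app W)
  have h10 : Function.Bijective (U.ι.appIso W).hom :=
    ConcreteCategory.bijective_of_isIso (U.ι.appIso W).hom
  refine ⟨fun a a' h => (h9.comp h10).1 ((h5 a).trans (h.trans (h5 a').symm)), fun y => ?_⟩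
  obtain ⟨a, ha⟩ := (h9.comp h10).2 y
  exact ⟨a, (h5 a).symm.trans ha⟩

end HigherDual

/-! ### Jets of sections in terms of coefficient functions -/

namespace HigherDual

section Germs

variable {X : Scheme.{0}} {L : X.Modules} {U : X.Opens}

/-- The germ of a local section of `L`. -/
noncomputable def localGerm (L : X.Modules) (U : X.Opens) (x : X) (hx : x ∈ U) :
    Γ(L, U) →+ Stalk L x := (L.presheaf.germ U x hx).hom

lemma localGerm_smul (x : X) (hx : x ∈ U) (r : Γ(X, U)) (s : Γ(L, U)) :
    localGerm L U x hx (r • s) = X.presheaf.germ U x hx r • localGerm L U x hx s :=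
  letI M : PresheafOfModules.{0} (X.presheaf ⋙ forget₂ CommRingCat RingCat) := L.val
  PresheafOfModules.germ_smul M x U hx r s

lemma localGerm_res {V : X.Opens} (h : V ≤ U) (x : X) (hx : x ∈ V) (s : Γ(L, U)) :
    localGerm L V x hx (L.presheaf.map (homOfLE h).op s) = localGerm L U x (h hx) s :=
  TopCat.Presheaf.germ_res_apply L.presheaf (homOfLE h) x hx s

/-- Elements of the stalks and relations between them are already defined on some neighbourhood,
where the generator gives a bijection. This is why `IsGenerator` involves all smaller open subsets.
-/
lemma IsGenerator.bijective_smul_germ {σ : Γ(L, U)} (hσ : IsGenerator σ) (x : X) (hx : x ∈ U) :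
    Function.Bijective fun r : X.presheaf.stalk x => r • localGerm L U x hx σ := by
  constructor
  · have h0 (r : X.presheaf.stalk x) (hr : r • localGerm L U x hx σ = 0) : r = 0 := by
      obtain ⟨V, hV, a, rfl⟩ := TopCat.Presheaf.exists_germ_eq X.presheaf r
      have hxV : x ∈ V ⊓ U := ⟨hV, hx⟩
      let a' : Γ(X, V ⊓ U) := X.presheaf.map (homOfLE inf_le_left).op a
      have ha' : X.presheaf.germ (V ⊓ U) x hxV a' = X.presheaf.germ V x hV a :=
        TopCat.Presheaf.germ_res_apply X.presheaf (homOfLE inf_le_left) x hxV a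
      let τ : Γ(L, V ⊓ U) := L.presheaf.map (homOfLE inf_le_right).op σ
      have h1 : localGerm L (V ⊓ U) x hxV (a' • τ) = localGerm L (V ⊓ U) x hxV 0 := by
        rw [localGerm_smul, ha', localGerm_res, hr, map_zero]
      obtain ⟨W, hxW, i, j, h2⟩ := TopCat.Presheaf.germ_eq L.presheaf x hxV hxV (a' • τ) 0 h1
      have h3 : L.presheaf.map i.op τ = L.presheaf.map (homOfLE (i.le.trans inf_le_right)).op σ := by
        simp only [τ, ← ConcreteCategory.comp_apply, ← Functor.map_comp]
        rfl
      rw [map_zero, Scheme.Modules.map_smul, h3] at h2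
      have h4 : X.presheaf.map i.op a' = 0 := by
        refine (hσ W (i.le.trans inf_le_right)).1 ?_
        change X.presheaf.map i.op a' • _ = (0 : Γ(X, W)) • _
        rw [h2, zero_smul]
      rw [← ha', ← TopCat.Presheaf.germ_res_apply X.presheaf i x hxW a']
      erw [h4]
      rw [map_zero]
    intro r r' h
    refine sub_eq_zero.1 (h0 _ ?_)
    rw [sub_smul]
    exact sub_eq_zero.2 h
  · intro y
    obtain ⟨V, hV, s, hs⟩ := TopCat.Presheaf.exists_germ_eq L.presheaf y
    have hxV : x ∈ V ⊓ U := ⟨hV, hx⟩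
    obtain ⟨a, ha⟩ := (hσ (V ⊓ U) inf_le_right).2 (L.presheaf.map (homOfLE inf_le_left).op s)
    refine ⟨X.presheaf.germ (V ⊓ U) x hxV a, ?_⟩
    change X.presheaf.germ (V ⊓ U) x hxV a • localGerm L U x hx σ = y
    rw [← localGerm_res inf_le_right x hxV σ, ← localGerm_smul]
    refine (congrArg (localGerm L (V ⊓ U) x hxV) ha).trans ?_
    rw [localGerm_res]
    exact hs

/-- The trivialization of a stalk by a generator. -/
noncomputable def IsGenerator.stalkEquiv {σ : Γ(L, U)} (hσ : IsGenerator σ) (x : X) (hx : x ∈ U) :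
    X.presheaf.stalk x ≃ₗ[X.presheaf.stalk x] Stalk L x :=
  LinearEquiv.ofBijective (LinearMap.toSpanSingleton _ _ (localGerm L U x hx σ))
    (hσ.bijective_smul_germ x hx)

lemma IsGenerator.smul_mem_iff {σ : Γ(L, U)} (hσ : IsGenerator σ) (x : X) (hx : x ∈ U)
    (I : Ideal (X.presheaf.stalk x)) (r : X.presheaf.stalk x) :
    r • localGerm L U x hx σ ∈ I • (⊤ : Submodule (X.presheaf.stalk x) (Stalk L x)) ↔ r ∈ I := by
  have h : I • (⊤ : Submodule (X.presheaf.stalk x) (Stalk L x)) =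
      Submodule.map (hσ.stalkEquiv x hx).toLinearMap I := by
    rw [← Submodule.map_top (hσ.stalkEquiv x hx).toLinearMap |>.trans
      (LinearEquiv.range (hσ.stalkEquiv x hx)), ← Submodule.map_smul'']
    simp
  rw [h]
  refine ⟨?_, fun hr => ⟨r, hr, rfl⟩⟩
  rintro ⟨r', hr', h'⟩
  rwa [← (hσ.bijective_smul_germ x hx).1 h']

end Germs

section Sections

variable {X : Scheme.{0}} (f : X ⟶ Spec (CommRingCat.of ℂ)) {L : X.Modules} (U : X.Opens)

/-- The algebra of functions on an open subset of a complex scheme. -/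
def Sections (_f : X ⟶ Spec (CommRingCat.of ℂ)) (U : X.Opens) : Type := Γ(X, U)

noncomputable instance : CommRing (Sections f U) := inferInstanceAs (CommRing Γ(X, U))

/-- The scalars `ℂ → Γ(X, U)`. -/
noncomputable def sectionScalars : ℂ →+* Γ(X, U) :=
  (X.presheaf.map (homOfLE le_top).op).hom.comp (scalars f)

noncomputable instance : Algebra ℂ (Sections f U) := (sectionScalars f U).toAlgebra

variable {U} {σ : Γ(L, U)} (hσ : IsGenerator σ)

/-- The restriction of global sections to `U`. -/
noncomputable def restriction (L : X.Modules) (U : X.Opens) : H0 f L →+ Γ(L, U) :=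
  (L.presheaf.map (homOfLE (le_top (a := U))).op).hom

lemma restriction_smul (c : ℂ) (s : H0 f L) :
    restriction f L U (c • s) = sectionScalars f U c • restriction f L U s :=
  Scheme.Modules.map_smul L (homOfLE le_top) (scalars f c) s

lemma germ_eq_localGerm_restriction (x : X) (hx : x ∈ U) (s : H0 f L) :
    germ f L x s = localGerm L U x hx (restriction f L U s) :=
  (localGerm_res le_top x hx s).symm

include hσ in
lemma IsGenerator.bijective : Function.Bijective fun a : Γ(X, U) => a • σ := by
  have h := hσ U le_rfl
  have h1 : L.presheaf.map (homOfLE (le_refl U)).op σ = σ :=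
    ConcreteCategory.congr_hom (L.presheaf.map_id (.op U)) σ
  rwa [h1] at h

/-- The coefficient of a global section with respect to a generator. -/
noncomputable def IsGenerator.coeffFun (s : H0 f L) : Γ(X, U) :=
  (hσ.bijective.2 (restriction f L U s)).choose

lemma IsGenerator.coeffFun_smul (s : H0 f L) : hσ.coeffFun f s • σ = restriction f L U s :=
  (hσ.bijective.2 (restriction f L U s)).choose_spec

/-- The coefficients of global sections with respect to a generator. -/
noncomputable def IsGenerator.coeff : H0 f L →ₗ[ℂ] Sections f U where
  toFun := hσ.coeffFun f
  map_add' s t := by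
    refine hσ.bijective.1 ?_
    change hσ.coeffFun f (s + t) • σ = (hσ.coeffFun f s + hσ.coeffFun f t) • σ
    rw [add_smul, coeffFun_smul, coeffFun_smul, coeffFun_smul, map_add]
  map_smul' c s := by
    refine hσ.bijective.1 ?_
    change hσ.coeffFun f (c • s) • σ = (sectionScalars f U c * hσ.coeffFun f s) • σ
    rw [mul_smul, coeffFun_smul, coeffFun_smul, restriction_smul]

/-- The germ of a function. -/
noncomputable def sectionGerm (U : X.Opens) (x : X) (hx : x ∈ U) :
    Sections f U →+* X.presheaf.stalk x := (X.presheaf.germ U x hx).hom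

lemma localGerm_smul_generator (x : X) (hx : x ∈ U) (a : Γ(X, U)) :
    localGerm L U x hx (a • σ) = sectionGerm f U x hx a • localGerm L U x hx σ :=
  localGerm_smul x hx a σ

lemma IsGenerator.germ_eq (x : X) (hx : x ∈ U) (s : H0 f L) :
    germ f L x s = sectionGerm f U x hx (hσ.coeff f s) • localGerm L U x hx σ := by
  rw [germ_eq_localGerm_restriction f x hx, ← hσ.coeffFun_smul, localGerm_smul]
  rfl

lemma IsGenerator.jet_eq_zero_iff (x : X) (hx : x ∈ U) (k : ℕ) (s : H0 f L) :
    jet f L k x s = 0 ↔ sectionGerm f U x hx (hσ.coeff f s) ∈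
      IsLocalRing.maximalIdeal (X.presheaf.stalk x) ^ (k + 1) := by
  rw [← hσ.smul_mem_iff x hx, ← hσ.germ_eq]
  exact Submodule.Quotient.mk_eq_zero _

lemma IsGenerator.exists_of_surjective (x : X) (hx : x ∈ U) (k : ℕ)
    (h : Function.Surjective (jet f L k x)) (a : Sections f U) :
    ∃ s : H0 f L, sectionGerm f U x hx (a - hσ.coeff f s) ∈
      IsLocalRing.maximalIdeal (X.presheaf.stalk x) ^ (k + 1) := by
  let a' : Γ(X, U) := a
  obtain ⟨s, hs⟩ := h (Submodule.Quotient.mk (localGerm L U x hx (a' • σ)))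
  refine ⟨s, (hσ.smul_mem_iff x hx _ _).1 ?_⟩
  have h1 := (Submodule.Quotient.eq _).1 hs.symm
  rw [localGerm_smul_generator f, hσ.germ_eq f x hx, ← sub_smul, ← map_sub] at h1
  exact h1

end Sections

end HigherDual

/-! ### Closed points and coordinates on affine opens -/

namespace HigherDual

variable {X : Scheme.{0}} (f : X ⟶ Spec (CommRingCat.of ℂ)) {L : X.Modules} {U : X.Opens}

section Points

variable (hU : IsAffineOpen U)

/-- The closed point of an affine open subset defined by a complex valued character. -/
noncomputable def pointOf (ψ : Sections f U →ₐ[ℂ] ℂ) : X :=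
  hU.fromSpec (⟨RingHom.ker ψ, RingHom.ker_isPrime ψ⟩ : PrimeSpectrum Γ(X, U))

lemma ker_isMaximal {A : Type*} [CommRing A] [Algebra ℂ A] (ψ : A →ₐ[ℂ] ℂ) :
    (RingHom.ker ψ).IsMaximal :=
  RingHom.ker_isMaximal_of_surjective ψ fun r => ⟨algebraMap ℂ A r, ψ.commutes r⟩

lemma pointOf_mem_basicOpen_iff (ψ : Sections f U →ₐ[ℂ] ℂ) (h : Sections f U) :
    pointOf f hU ψ ∈ X.basicOpen (show Γ(X, U) from h) ↔ ψ h ≠ 0 := by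
  let y : PrimeSpectrum Γ(X, U) := ⟨RingHom.ker ψ, RingHom.ker_isPrime ψ⟩
  change y ∈ hU.fromSpec ⁻¹ᵁ X.basicOpen (show Γ(X, U) from h) ↔ _
  rw [hU.fromSpec_preimage_basicOpen]
  rfl

lemma pointOf_mem (ψ : Sections f U →ₐ[ℂ] ℂ) : pointOf f hU ψ ∈ U := by
  have h : pointOf f hU ψ ∈ Set.range hU.fromSpec := ⟨_, rfl⟩
  rwa [hU.range_fromSpec] at h

include f in
lemma jacobsonSpace [LocallyOfFiniteType f] : JacobsonSpace X :=
  have : JacobsonSpace (Spec (CommRingCat.of ℂ)) :=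
    inferInstanceAs (JacobsonSpace (PrimeSpectrum ℂ))
  LocallyOfFiniteType.jacobsonSpace f

/-- The point is closed in an affine open subset, hence locally closed in `X`, and in a Jacobson
space a locally closed point is closed. -/
lemma isClosed_pointOf [LocallyOfFiniteType f] (ψ : Sections f U →ₐ[ℂ] ℂ) :
    IsClosed ({pointOf f hU ψ} : Set X) := by
  have : JacobsonSpace X := jacobsonSpace f
  apply isClosed_singleton_of_isLocallyClosed_singleton
  let y : PrimeSpectrum Γ(X, U) := ⟨RingHom.ker ψ, RingHom.ker_isPrime ψ⟩
  have h1 : IsClosed ({y} : Set (PrimeSpectrum Γ(X, U))) :=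
    (PrimeSpectrum.isClosed_singleton_iff_isMaximal y).2 (ker_isMaximal ψ)
  have h2 := h1.isLocallyClosed.image hU.fromSpec.isOpenEmbedding.isInducing
    hU.fromSpec.isOpenEmbedding.isOpen_range.isLocallyClosed
  have h3 : hU.fromSpec '' {y} = {pointOf f hU ψ} := Set.image_singleton
  exact h3 ▸ h2

lemma exists_pointOf_eq [Algebra.FiniteType ℂ (Sections f U)] {x : X} (hx : x ∈ U)
    (hx' : IsClosed ({x} : Set X)) : ∃ ψ : Sections f U →ₐ[ℂ] ℂ, pointOf f hU ψ = x := by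
  let I : Ideal (Sections f U) := (hU.primeIdealOf ⟨x, hx⟩).asIdeal
  have : I.IsMaximal := hU.primeIdealOf_isMaximal_of_isClosed ⟨x, hx⟩ hx'
  obtain ⟨ψ, hψ⟩ := I.exists_algHom_ker_eq (F := ℂ)
  refine ⟨ψ, ?_⟩
  have h : (⟨RingHom.ker ψ, RingHom.ker_isPrime ψ⟩ : PrimeSpectrum Γ(X, U)) =
    hU.primeIdealOf ⟨x, hx⟩ := PrimeSpectrum.ext hψ
  exact (congrArg hU.fromSpec h).trans (hU.fromSpec_primeIdealOf ⟨x, hx⟩)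

/-- The stalk is the localization at the maximal ideal `ker ψ`, and the powers of a maximal ideal
are contracted from this localization. -/
lemma sectionGerm_mem_iff (ψ : Sections f U →ₐ[ℂ] ℂ) (k : ℕ) (a : Sections f U) :
    sectionGerm f U (pointOf f hU ψ) (pointOf_mem f hU ψ) a ∈
      IsLocalRing.maximalIdeal (X.presheaf.stalk (pointOf f hU ψ)) ^ k ↔
      a ∈ RingHom.ker ψ ^ k := by
  let y : PrimeSpectrum Γ(X, U) := ⟨RingHom.ker ψ, RingHom.ker_isPrime ψ⟩
  have : y.asIdeal.IsMaximal := ker_isMaximal ψ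
  let : Algebra Γ(X, U) (X.presheaf.stalk (hU.fromSpec y)) :=
    TopCat.Presheaf.algebra_section_stalk X.presheaf (⟨hU.fromSpec y, pointOf_mem f hU ψ⟩ : U)
  have : IsLocalization.AtPrime (X.presheaf.stalk (hU.fromSpec y)) y.asIdeal :=
    hU.isLocalization_stalk' y (pointOf_mem f hU ψ)
  have h := IsLocalization.AtPrime.under_maximalIdeal_pow y.asIdeal
    (X.presheaf.stalk (hU.fromSpec y)) k
  exact (Ideal.ext_iff.1 h) a

end Points

section Smooth

/-- A standard smooth chart can be shrunk to a basic open subset, because a localization away from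
an element is standard smooth of relative dimension `0`. -/
lemma exists_affine_standardSmooth (n : ℕ) [SmoothOfRelativeDimension n f] (x : X) (W : X.Opens)
    (hx : x ∈ W) : ∃ U : X.Opens, IsAffineOpen U ∧ x ∈ U ∧ U ≤ W ∧
      Algebra.IsStandardSmoothOfRelativeDimension n ℂ (Sections f U) := by
  obtain ⟨S, hS, V, hV, hxV, hVS, hf⟩ :=
    SmoothOfRelativeDimension.exists_isStandardSmoothOfRelativeDimension (n := n) (f := f) x
  obtain ⟨h, hW, hxh⟩ := hV.exists_basicOpen_le ⟨x, hx⟩ hxV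
  refine ⟨X.basicOpen h, hV.basicOpen h, hxh, hW, ?_⟩
  have hST : S = ⊤ := by
    have : Subsingleton (Spec (CommRingCat.of ℂ)) :=
      inferInstanceAs (Subsingleton (PrimeSpectrum ℂ))
    refine eq_top_iff.2 fun y _ => ?_
    rw [Subsingleton.elim y (f x)]
    exact hVS hxV
  subst hST
  have := hV.isLocalization_basicOpen h
  have h1 : (algebraMap Γ(X, V) Γ(X, X.basicOpen h)).IsStandardSmoothOfRelativeDimension 0 :=
    RingHom.IsStandardSmoothOfRelativeDimension.algebraMap_isLocalizationAway h
  have h2 := zero_add n ▸ RingHom.IsStandardSmoothOfRelativeDimension.comp h1 hf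
  have h3 := RingHom.isStandardSmoothOfRelativeDimension_respectsIso.2 _
    (Scheme.ΓSpecIso (CommRingCat.of ℂ)).symm.commRingCatIsoToRingEquiv h2
  have h4 : sectionScalars f (X.basicOpen h) =
      ((algebraMap Γ(X, V) Γ(X, X.basicOpen h)).comp (f.appLE ⊤ V hVS).hom).comp
        (Scheme.ΓSpecIso (CommRingCat.of ℂ)).symm.commRingCatIsoToRingEquiv.toRingHom := by
    ext c
    have h5 := ConcreteCategory.congr_hom
      (f.appLE_map hVS (homOfLE (X.basicOpen_le h)).op)
      ((Scheme.ΓSpecIso (CommRingCat.of ℂ)).inv c)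
    exact h5.symm
  have h5 : RingHom.IsStandardSmoothOfRelativeDimension n (sectionScalars f (X.basicOpen h)) := by
    rw [h4]
    exact h3
  exact h5

/-- A standard smooth algebra has local coordinates. -/
lemma nonempty_localCoordinates {A : Type} [CommRing A] [Nontrivial A] [Algebra ℂ A] {n : ℕ}
    [h : Algebra.IsStandardSmoothOfRelativeDimension n ℂ A] :
    Nonempty (LocalCoordinates ℂ A n) := by
  obtain ⟨ι, σ, _, _, P, hP⟩ := h.out
  -- The coordinates are the variables of a submersive presentation that are not matched with a
  -- relation; their differentials are a basis.
  have hcard : Nat.card ((Set.range P.map)ᶜ : Set ι) = n := by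
    rw [Nat.card_coe_set_eq, Set.ncard_compl, Set.ncard_range_of_injective P.map_inj, ← hP,
      Algebra.Presentation.dimension]
  let E := Finite.equivFinOfCardEq hcard
  exact ⟨⟨fun i => P.val (E.symm i), P.basisKaehler.reindex E, fun i => by simp⟩⟩

end Smooth

end HigherDual

/-! ### Charts and the ideal of the total cone -/

namespace HigherDual

/-- A chart of a complex scheme for which a sheaf of modules is trivial: an algebra `A` of functions
on an affine open subset, with local coordinates, and the map that trivializes the global
sections. -/
structure JetChart {X : Scheme.{0}} (f : X ⟶ Spec (CommRingCat.of ℂ)) (L : X.Modules) (n : ℕ)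
    (A : Type) [CommRing A] [Algebra ℂ A] where
  /-- The open subset. -/
  U : X.Opens
  /-- The local coordinates. -/
  coord : LocalCoordinates ℂ A n
  /-- The trivialization of the global sections. -/
  coeff : H0 f L →ₗ[ℂ] A
  /-- The points of the chart. -/
  point : (A →ₐ[ℂ] ℂ) → X
  /-- The basic open subsets. -/
  basicOpen : A → X.Opens
  isClosed_point (ψ : A →ₐ[ℂ] ℂ) : IsClosed ({point ψ} : Set X)
  exists_point_eq {x : X} : x ∈ U → IsClosed ({x} : Set X) → ∃ ψ, point ψ = x
  point_mem_basicOpen_iff (ψ : A →ₐ[ℂ] ℂ) (h : A) : point ψ ∈ basicOpen h ↔ ψ h ≠ 0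
  basicOpen_le (h : A) : basicOpen h ≤ U
  exists_basicOpen_le (W : X.Opens) : (W : Set X).Nonempty → ∃ h ≠ 0, basicOpen h ≤ W
  jet_eq_zero_iff (ψ : A →ₐ[ℂ] ℂ) (k : ℕ) (s : H0 f L) :
    jet f L k (point ψ) s = 0 ↔ coeff s ∈ RingHom.ker ψ ^ (k + 1)
  exists_of_surjective (ψ : A →ₐ[ℂ] ℂ) (k : ℕ) :
    Function.Surjective (jet f L k (point ψ)) → ∀ a, ∃ s, a - coeff s ∈ RingHom.ker ψ ^ (k + 1)

lemma exists_jetChart {X : Scheme.{0}} (f : X ⟶ Spec (CommRingCat.of ℂ))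
    [AlgebraicGeometry.IsIntegral X] (n : ℕ) [SmoothOfRelativeDimension n f] (L : X.Modules)
    [IsLineBundle L] (x : X) :
    ∃ (A : Type) (_ : CommRing A) (_ : IsDomain A) (_ : Algebra ℂ A) (_ : Algebra.FiniteType ℂ A)
      (C : JetChart f L n A), x ∈ C.U := by
  obtain ⟨W, hxW, σ₀, hσ₀⟩ := exists_isGenerator L x
  obtain ⟨U, hU, hxU, hUW, hsm⟩ := exists_affine_standardSmooth f n x W hxW
  let σ : Γ(L, U) := L.presheaf.map (homOfLE hUW).op σ₀
  have hσ : IsGenerator σ := by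
    intro V hV
    have h1 : L.presheaf.map (homOfLE hV).op σ = L.presheaf.map (homOfLE (hV.trans hUW)).op σ₀ := by
      simp only [σ, ← ConcreteCategory.comp_apply, ← Functor.map_comp]
      rfl
    rw [h1]
    exact hσ₀ V (hV.trans hUW)
  have : Nonempty U := ⟨⟨x, hxU⟩⟩
  have hdom : IsDomain (Sections f U) := inferInstanceAs (IsDomain Γ(X, U))
  have hft : Algebra.FiniteType ℂ (Sections f U) :=
    have := Algebra.IsStandardSmoothOfRelativeDimension.isStandardSmooth n (R := ℂ)
      (S := Sections f U)
    inferInstance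
  have : Smooth f := SmoothOfRelativeDimension.smooth n f
  have : LocallyOfFiniteType f := inferInstance
  obtain ⟨c⟩ := nonempty_localCoordinates (A := Sections f U) (n := n)
  refine ⟨Sections f U, inferInstance, hdom, inferInstance, hft,
    { U := U
      coord := c
      coeff := hσ.coeff f
      point := pointOf f hU
      basicOpen h := X.basicOpen (show Γ(X, U) from h)
      isClosed_point := isClosed_pointOf f hU
      exists_point_eq := exists_pointOf_eq f hU
      point_mem_basicOpen_iff := pointOf_mem_basicOpen_iff f hU
      basicOpen_le h := X.basicOpen_le _
      exists_basicOpen_le W hW := ?_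
      jet_eq_zero_iff ψ k s := by
        rw [hσ.jet_eq_zero_iff f _ (pointOf_mem f hU ψ), sectionGerm_mem_iff]
      exists_of_surjective ψ k h a := by
        obtain ⟨s, hs⟩ := hσ.exists_of_surjective f _ (pointOf_mem f hU ψ) k h a
        exact ⟨s, (sectionGerm_mem_iff f hU ψ _ _).1 hs⟩ }, hxU⟩
  -- By irreducibility every nonempty open subset meets the chart.
  obtain ⟨y, hyW, hyU⟩ := nonempty_preirreducible_inter W.isOpen U.isOpen hW ⟨x, hxU⟩
  obtain ⟨h, hh, hyh⟩ := hU.exists_basicOpen_le (V := W) ⟨y, hyW⟩ hyU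
  refine ⟨h, ?_, hh⟩
  rintro rfl
  have h0 : X.basicOpen (0 : Γ(X, U)) = ⊥ := Scheme.basicOpen_zero _ _
  change y ∈ X.basicOpen (0 : Γ(X, U)) at hyh
  rw [h0] at hyh
  exact hyh

section Cone

variable {X : Scheme.{0}} (f : X ⟶ Spec (CommRingCat.of ℂ)) (L : X.Modules)
  {ι : Type} [Fintype ι] (b : ι → H0 f L) (k : ℕ)

/-- The coefficients of the sections with a vanishing `k`-jet at `x`. -/
def fiberCone (x : X) : Set (ι → ℂ) := {v | jet f L k x (∑ i, v i • b i) = 0}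

/-- The coefficients of the sections with a vanishing `k`-jet at some point. -/
def totalCone : Set (ι → ℂ) := {v | ∃ x : X, IsClosed ({x} : Set X) ∧ v ∈ fiberCone f L b k x}

variable {f L}

lemma JetChart.fiberCone_point {n : ℕ} {A : Type} [CommRing A] [Algebra ℂ A] (C : JetChart f L n A)
    (ψ : A →ₐ[ℂ] ℂ) : fiberCone f L b k (C.point ψ) = jetCone (fun i => C.coeff (b i)) k ψ := by
  ext v
  rw [fiberCone, Set.mem_ofPred_eq, C.jet_eq_zero_iff, map_sum]
  simp only [map_smul]
  rfl

/-- Around a closed point, the closure of the union of the cones of the sections with a vanishing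
`k`-jet is irreducible of the expected dimension. -/
lemma exists_local_equations [AlgebraicGeometry.IsIntegral X] (n : ℕ)
    [SmoothOfRelativeDimension n f] [IsLineBundle L] (hb : ⊤ ≤ Submodule.span ℂ (Set.range b))
    (hk : 1 ≤ k) (hL : IsJetSpanned f L (k + 1)) {x : X} (hx : IsClosed ({x} : Set X)) :
    ∃ I : Ideal (MvPolynomial ι ℂ),
      (∃ d : ℕ, ringKrullDim (MvPolynomial ι ℂ ⧸ I) = d ∧
        d + (n + k).choose k = n + Fintype.card ι) ∧
      (∀ W : X.Opens, (W : Set X).Nonempty → ∀ p : MvPolynomial ι ℂ,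
        (∀ y ∈ W, IsClosed ({y} : Set X) → ∀ v ∈ fiberCone f L b k y, MvPolynomial.eval v p = 0) →
          p ∈ I) ∧
      ∃ W : X.Opens, x ∈ W ∧ ∀ p ∈ I, ∀ y ∈ W, IsClosed ({y} : Set X) →
        ∀ v ∈ fiberCone f L b k y, MvPolynomial.eval v p = 0 := by
  classical
  obtain ⟨A, _, _, _, _, C, hxC⟩ := exists_jetChart f n L x
  obtain ⟨ψ, rfl⟩ := C.exists_point_eq hxC hx
  have hspan : SpansJets (fun i => C.coeff (b i)) (k + 1) ψ := by
    intro a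
    obtain ⟨s, hs⟩ := C.exists_of_surjective ψ (k + 1) (hL _ hx) a
    obtain ⟨v, rfl⟩ := (Submodule.mem_span_range_iff_exists_fun ℂ).1
      (hb (Submodule.mem_top (x := s)))
    refine ⟨v, ?_⟩
    rw [map_sum] at hs
    simpa only [map_smul] using hs
  have hspan' : SpansJets (fun i => C.coeff (b i)) k ψ := fun a => by
    obtain ⟨v, hv⟩ := hspan a
    exact ⟨v, Ideal.pow_le_pow_right (k + 1).le_succ hv⟩
  obtain ⟨e, w, he, hw, hψ⟩ := C.coord.exists_minor _ k hspan'
  have hdet : (C.coord.minor (fun i => C.coeff (b i)) e w).det ≠ 0 :=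
    fun h => hψ ((congrArg ψ h).trans (map_zero ψ))
  refine ⟨RingHom.ker (C.coord.universalHom (fun i => C.coeff (b i)) e w),
    C.coord.ringKrullDim_quotient_ker he hw hk hspan hψ, ?_,
    C.basicOpen (C.coord.minor (fun i => C.coeff (b i)) e w).det,
    (C.point_mem_basicOpen_iff _ _).2 hψ, ?_⟩
  · intro W hW p hp
    obtain ⟨h, h0, hh⟩ := C.exists_basicOpen_le W hW
    refine C.coord.universalHom_eq_zero_of_eval_eq_zero hw hdet h0 fun χ hχ v hv => ?_
    refine hp _ (hh ((C.point_mem_basicOpen_iff _ _).2 hχ)) (C.isClosed_point χ) v ?_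
    rwa [C.fiberCone_point]
  · intro p hp y hy hy' v hv
    obtain ⟨χ, rfl⟩ := C.exists_point_eq (C.basicOpen_le _ hy) hy'
    rw [C.fiberCone_point] at hv
    exact C.coord.eval_eq_zero_of_universalHom_eq_zero he hw hp
      ((C.point_mem_basicOpen_iff _ _).1 hy) hv

/-- The dimension of the closure of the cone of the sections with a vanishing `k`-jet at some
point. -/
theorem ringKrullDim_totalCone [AlgebraicGeometry.IsIntegral X] (n : ℕ)
    [SmoothOfRelativeDimension n f] [IsLineBundle L] (hb : ⊤ ≤ Submodule.span ℂ (Set.range b))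
    (hk : 1 ≤ k) (hL : IsJetSpanned f L (k + 1)) {x : X} (hx : IsClosed ({x} : Set X)) :
    ∃ d : ℕ, ringKrullDim (MvPolynomial ι ℂ ⧸
      MvPolynomial.vanishingIdeal ℂ (totalCone f L b k)) = d ∧
        d + (n + k).choose k = n + Fintype.card ι := by
  obtain ⟨I, hI, hI1, W, hxW, hI2⟩ := exists_local_equations b k n hb hk hL hx
  -- An element of `I` vanishes on the fibres over a neighbourhood of `x`, hence lies in the ideal
  -- `J` attached to any other closed point `y`, hence vanishes on the fibre over `y`.
  have h : MvPolynomial.vanishingIdeal ℂ (totalCone f L b k) = I := by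
    apply le_antisymm
    · intro p hp
      refine hI1 W ⟨x, hxW⟩ p fun y _ hy v hv => ?_
      exact MvPolynomial.mem_vanishingIdeal_iff.1 hp v ⟨y, hy, hv⟩
    · intro p hp
      refine MvPolynomial.mem_vanishingIdeal_iff.2 ?_
      rintro v ⟨y, hy, hv⟩
      obtain ⟨J, -, hJ1, W', hyW', hJ2⟩ := exists_local_equations b k n hb hk hL hy
      exact hJ2 p (hJ1 W ⟨x, hxW⟩ p (hI2 p hp)) y hyW' hy v hv
  rw [h]
  exact hI

end Cone

end HigherDual

/-! ### Affine cones and the projective closure -/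

namespace HigherDual

section Cone

variable {V : Type*} [AddCommGroup V] [Module ℂ V] {m : ℕ} (b : Module.Basis (Fin (m + 1)) ℂ V)

lemma subset_zariskiClosure (Z : Set (Projectivization ℂ V)) : Z ⊆ zariskiClosure b Z :=
  fun _ hz _ _ _ hp => hp _ hz

lemma _root_.MvPolynomial.IsHomogeneous.eval_smul {σ R : Type*} [CommRing R]
    {p : MvPolynomial σ R} {d : ℕ} (hp : p.IsHomogeneous d) (c : R) (v : σ → R) :
    MvPolynomial.eval (c • v) p = c ^ d * MvPolynomial.eval v p := by
  classical
  rw [MvPolynomial.eval_eq, MvPolynomial.eval_eq, Finset.mul_sum]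
  refine Finset.sum_congr rfl fun a ha => ?_
  have h : ∑ i ∈ a.support, a i = d := by
    rw [← hp (MvPolynomial.mem_support_iff.1 ha), Finsupp.weight_apply, Finsupp.sum]
    simp
  simp only [Pi.smul_apply, smul_eq_mul, mul_pow, Finset.prod_mul_distrib,
    Finset.prod_pow_eq_pow_sum, h]
  ring

/-- If a polynomial vanishes on a line through the origin, then so do its homogeneous
components. -/
lemma _root_.MvPolynomial.eval_homogeneousComponent_eq_zero {σ K : Type*} [Field K] [Infinite K]
    {p : MvPolynomial σ K} {v : σ → K} (h : ∀ c : K, MvPolynomial.eval (c • v) p = 0) (d : ℕ) :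
    MvPolynomial.eval v (MvPolynomial.homogeneousComponent d p) = 0 := by
  -- This is the restriction `c ↦ p (c • v)` of `p` to the line, graded by degree.
  let q : Polynomial K := ∑ i ∈ Finset.range (p.totalDegree + 1),
    Polynomial.monomial i (MvPolynomial.eval v (MvPolynomial.homogeneousComponent i p))
  have hq : q = 0 := by
    refine Polynomial.funext fun c => ?_
    rw [Polynomial.eval_zero, ← h c]
    conv_rhs => rw [← MvPolynomial.sum_homogeneousComponent p]
    rw [Polynomial.eval_finsetSum, map_sum]
    refine Finset.sum_congr rfl fun i _ => ?_
    rw [Polynomial.eval_monomial,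
      (MvPolynomial.homogeneousComponent_isHomogeneous i p).eval_smul, mul_comm]
  by_cases hd : d < p.totalDegree + 1
  · have := congrArg (fun r => Polynomial.coeff r d) hq
    simpa [q, Polynomial.coeff_monomial, hd] using this
  · rw [MvPolynomial.homogeneousComponent_eq_zero _ _ (by lia), map_zero]

/-- The closure tests only homogeneous polynomials. This loses nothing, because an affine cone is
stable under scaling, so the homogeneous components of a polynomial vanishing on it vanish there
too. -/
lemma vanishingIdeal_affineCone_zariskiClosure (Z : Set (Projectivization ℂ V)) :
    MvPolynomial.vanishingIdeal ℂ (affineCone b (zariskiClosure b Z)) =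
      MvPolynomial.vanishingIdeal ℂ (affineCone b Z) := by
  apply le_antisymm
  · intro p hp
    refine MvPolynomial.mem_vanishingIdeal_iff.2 fun v hv =>
      MvPolynomial.mem_vanishingIdeal_iff.1 hp v ?_
    exact hv.imp_right fun ⟨z, hz, h⟩ => ⟨z, subset_zariskiClosure b Z hz, h⟩
  · intro p hp
    rw [MvPolynomial.mem_vanishingIdeal_iff] at hp
    refine MvPolynomial.mem_vanishingIdeal_iff.2 ?_
    rintro v (rfl | ⟨z, hz, c, rfl⟩)
    · exact hp 0 (Or.inl rfl)
    · have h (d : ℕ) : MvPolynomial.eval (b.repr z.rep)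
          (MvPolynomial.homogeneousComponent d p) = 0 := by
        refine hz _ d (MvPolynomial.homogeneousComponent_isHomogeneous d p) fun y hy => ?_
        refine MvPolynomial.eval_homogeneousComponent_eq_zero (fun a => ?_) d
        exact hp _ (Or.inr ⟨y, hy, a, rfl⟩)
      change MvPolynomial.eval _ p = 0
      rw [← MvPolynomial.sum_homogeneousComponent p, map_sum]
      refine Finset.sum_eq_zero fun d _ => ?_
      rw [(MvPolynomial.homogeneousComponent_isHomogeneous d p).eval_smul, h, mul_zero]

end Cone

section Tangent

variable {X : Scheme.{0}} (f : X ⟶ Spec (CommRingCat.of ℂ)) (L : X.Modules)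

/-- The osculating space lies in the hyperplane of a section if and only if the jet of the section
vanishes. -/
lemma osculatingSpace_le_hyperplane_iff (k : ℕ) (x : X) (s : H0 f L) :
    osculatingSpace f L k x ≤ hyperplane f L s ↔ jet f L k x s = 0 := by
  rw [← Module.forall_dual_apply_eq_zero_iff ℂ]
  constructor
  · exact fun h φ => h ⟨φ, rfl⟩
  · rintro h _ ⟨φ, rfl⟩
    exact h φ

variable {m : ℕ} (b : Module.Basis (Fin (m + 1)) ℂ (H0 f L)) (k : ℕ)

/-- A hyperplane contains the osculating space exactly when the jet of its section vanishes, a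
condition stable under scaling. The closed point `x` serves only for the vertex, which lies in
`totalCone` as soon as there is some fibre. -/
lemma affineCone_tangentHyperplanes {x : X} (hx : IsClosed ({x} : Set X)) :
    affineCone b (tangentHyperplanes f L k) = totalCone f L b k := by
  ext v
  constructor
  · rintro (rfl | ⟨H, ⟨y, hy, h⟩, c, rfl⟩)
    · exact ⟨x, hx, by simp [fiberCone]⟩
    · refine ⟨y, hy, ?_⟩
      rw [osculatingSpace_le_hyperplane_iff] at h
      have : ∑ i, (c • ⇑(b.repr H.rep)) i • b i = c • H.rep := by
        conv_rhs => rw [← b.sum_repr H.rep, Finset.smul_sum]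
        simp [mul_smul]
      rw [fiberCone, Set.mem_ofPred_eq, this, map_smul, h, smul_zero]
  · rintro ⟨y, hy, h⟩
    by_cases hv : v = 0
    · exact Or.inl hv
    have hrepr : ⇑(b.repr (∑ i, v i • b i)) = v := b.repr_sum_self v
    have hs : ∑ i, v i • b i ≠ 0 := fun h0 => hv (by rw [← hrepr, h0, map_zero]; rfl)
    obtain ⟨a, ha⟩ := Projectivization.exists_smul_eq_mk_rep ℂ _ hs
    refine Or.inr ⟨Projectivization.mk ℂ _ hs, ⟨y, hy, ?_⟩, (a⁻¹ : ℂˣ), ?_⟩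
    · rw [osculatingSpace_le_hyperplane_iff, ← ha, Units.smul_def, map_smul]
      have h' : jet f L k y (∑ i, v i • b i) = 0 := h
      rw [h', smul_zero]
    · rw [← ha, Units.smul_def, map_smul, Finsupp.coe_smul, hrepr, smul_smul, Units.inv_mul,
        one_smul]

end Tangent

lemma exists_isClosed_singleton {X : Scheme.{0}} (f : X ⟶ Spec (CommRingCat.of ℂ))
    [LocallyOfFiniteType f] [Nonempty X] : ∃ x : X, IsClosed ({x} : Set X) := by
  have := jacobsonSpace f
  by_contra! h
  have h0 : closedPoints X = ∅ := Set.eq_empty_of_forall_notMem h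
  have h1 := closure_closedPoints (X := X)
  rw [h0, closure_empty] at h1
  exact Set.empty_ne_univ h1

end HigherDual

theorem mainTheorem9 {X : Scheme.{0}} (f : X ⟶ Spec (CommRingCat.of ℂ)) [AlgebraicGeometry.IsIntegral X]
    [IsProper f] (n : ℕ) [SmoothOfRelativeDimension n f]
    (L : X.Modules) [HigherDual.IsLineBundle L]
    (m : ℕ) (b : Module.Basis (Fin (m + 1)) ℂ (HigherDual.H0 f L))
    (k : ℕ) (hk : 1 ≤ k) (hL : HigherDual.IsJetSpanned f L (k + 1)) :
    HigherDual.HasCodimension b (HigherDual.dualVariety f L b k) (Nat.choose (n + k) k - n) := by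
  obtain ⟨x, hx⟩ := HigherDual.exists_isClosed_singleton f
  obtain ⟨d, hd, hdn⟩ := HigherDual.ringKrullDim_totalCone b k n b.span_eq.ge hk hL hx
  -- This makes the truncated subtraction in the codimension exact; `1 ≤ k` is needed for it.
  have hn : n ≤ (n + k).choose k := by
    rw [add_comm, Nat.choose_symm_add]
    calc n ≤ (1 + n).choose n := by rw [add_comm, Nat.choose_succ_self_right]; exact n.le_succ
      _ ≤ (k + n).choose n := Nat.choose_le_choose n (by lia)
  rw [← HigherDual.affineCone_tangentHyperplanes f L b k hx,
    ← HigherDual.vanishingIdeal_affineCone_zariskiClosure] at hd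
  rw [Fintype.card_fin] at hdn
  have h : d + ((n + k).choose k - n) = m + 1 := by lia
  refine (congrArg (· + (((n + k).choose k - n : ℕ) : WithBot ℕ∞)) hd).trans ?_
  exact_mod_cast congrArg (Nat.cast (R := WithBot ℕ∞)) h
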